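/- Let $d\in\{2,3\}$ and let $\Omega\subset\mathbb{R}^d$ be a bounded Lipschitz open set whose open complement $\mathbb{R}^d\setminus\overline{\Omega}$ is connected. For $k>0$ let $\Phi_k(x,y)=\frac{\mathrm i}{4}H^{(1)}_0(k|x-y|)$ if $d=2$ and $\Phi_k(x,y)=\frac{\mathrm e^{\mathrm i k|x-y|}}{4\pi|x-y|}$ if $d=3$, and let $S_k$ be the single-layer operator $$S_k\phi(x)=\int_{\partial\Omega}\Phi_k(x,y)\,\phi(y)\,\mathrm ds(y),\qquad \phi\in L^2(\partial\Omega),\ x\in\partial\Omega .$$ Let $H^1(\partial\Omega)$ be the completion of $\{u|_{\partial\Omega}:u\in C_c^\infty(\mathbb{R}^d)\}$ in the norm $\|u\|_{H^1(\partial\Omega)}=\big(\int_{\partial\Omega}(|\nabla_{\partial\Omega}u|^2+|u|^2)\,\mathrm ds\big)^{1/2}$, where $\nabla_{\partial\Omega}$ is the surface gradient. Suppose that $\partial\Omega$ contains a line segment $\{a+te:|t|<\delta\}$, for some $a\in\mathbb{R}^d$, some unit vector $e$ and some $\delta>0$, and that $\partial\Omega$ is $C^2$ in a neighbourhood of this segment.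 Then there exist $k_0>0$ and $C>0$, independent of $k$, such that, for all $k\ge k_0$, $$\|S_k\|_{L^2(\partial\Omega)\to L^2(\partial\Omega)}\ \ge\ C\,k^{-1/2}\qquad\text{and}\qquad \|S_k\|_{L^2(\partial\Omega)\to H^1(\partial\Omega)}\ \ge\ C\,k^{1/2}.$$ Here an operator norm is the supremum of the norm of $S_k\phi$ over $\|\phi\|_{L^2(\partial\Omega)}\le1$, with values in $[0,\infty]$ (a function outside the target space has norm $\infty$). -/

import Mathlib

open MeasureTheory Filter Topology Set
open scoped ENNReal NNReal ContDiff RealInnerProductSpace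

noncomputable section

namespace Helmholtz

/-- `ℝᵈ` with the Euclidean norm. -/
abbrev Space (d : ℕ) : Type := EuclideanSpace ℝ (Fin d)

/-! ### The fundamental solution -/

/-- The Bessel function of the first kind of order zero,
`J₀(t) = ∑ₘ (-1)ᵐ (t²/4)ᵐ / (m!)²`. -/
def besselJ0 (t : ℝ) : ℝ :=
  ∑' m : ℕ, (-1) ^ m * (t ^ 2 / 4) ^ m / (m.factorial : ℝ) ^ 2

/-- The Bessel function of the second kind of order zero, for `t > 0`:
`Y₀(t) = (2/π) (log (t/2) + γ) J₀(t) - (2/π) ∑ₘ (-1)ᵐ hₘ (t²/4)ᵐ / (m!)²`, where `γ` is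
Euler's constant and `hₘ = 1 + 1/2 + ⋯ + 1/m` (so the term `m = 0` vanishes). -/
def besselY0 (t : ℝ) : ℝ :=
  2 / Real.pi * (Real.log (t / 2) + Real.eulerMascheroniConstant) * besselJ0 t
    - 2 / Real.pi * ∑' m : ℕ,
        (-1) ^ m * (harmonic m : ℝ) * (t ^ 2 / 4) ^ m / (m.factorial : ℝ) ^ 2

/-- The Hankel function of the first kind of order zero, `H₀⁽¹⁾ = J₀ + i Y₀`, on `(0, ∞)`. -/
def hankelH0 (t : ℝ) : ℂ := (besselJ0 t : ℂ) + Complex.I * (besselY0 t : ℂ)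

/-- The outgoing fundamental solution `Φ_k(x, y)` of the Helmholtz equation `Δu + k²u = 0`:
`(i/4) H₀⁽¹⁾(k|x-y|)` for `d = 2` and `e^{ik|x-y|} / (4π|x-y|)` for `d = 3`.
It is used for these two dimensions only. -/
def fundamentalSolution (d : ℕ) (k : ℝ) (x y : Space d) : ℂ :=
  if d = 2 then Complex.I / 4 * hankelH0 (k * ‖x - y‖)
  else Complex.exp (Complex.I * k * ‖x - y‖) / (4 * Real.pi * ‖x - y‖)

/-! ### The domain -/

/-- Near `x`, the set `Ω` is the region below the graph of a Lipschitz function, after a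
rotation of the coordinates that makes the unit vector `ν` vertical; the function lives on the
hyperplane orthogonal to `ν`. -/
def IsLipschitzHypographAt {d : ℕ} (Ω : Set (Space d)) (x : Space d) : Prop :=
  ∃ (ν : Space d) (γ : (ℝ ∙ ν)ᗮ → ℝ) (L : ℝ≥0), ‖ν‖ = 1 ∧ LipschitzWith L γ ∧
    ∀ᶠ y in 𝓝 x, (y ∈ Ω ↔ ⟪ν, y⟫ < γ ((ℝ ∙ ν)ᗮ.orthogonalProjectionOnto y))

/-- `Ω` is a bounded Lipschitz open set whose open complement `ℝᵈ \ closure Ω` is connected. -/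
structure IsLipschitzObstacle {d : ℕ} (Ω : Set (Space d)) : Prop where
  isOpen : IsOpen Ω
  isBounded : Bornology.IsBounded Ω
  lipschitz : ∀ x ∈ frontier Ω, IsLipschitzHypographAt Ω x
  connected : IsConnected (closure Ω)ᶜ

/-- Near `x`, the boundary of `Ω` is the graph of a `C²` function over a hyperplane. -/
def IsC2BoundaryAt {d : ℕ} (Ω : Set (Space d)) (x : Space d) : Prop :=
  ∃ (ν : Space d) (γ : (ℝ ∙ ν)ᗮ → ℝ), ‖ν‖ = 1 ∧ ContDiff ℝ 2 γ ∧
    ∀ᶠ y in 𝓝 x, (y ∈ frontier Ω ↔ ⟪ν, y⟫ = γ ((ℝ ∙ ν)ᗮ.orthogonalProjectionOnto y))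

/-- The boundary of `Ω` is `C²` in a neighbourhood of the set `s`. -/
def IsC2BoundaryNear {d : ℕ} (Ω s : Set (Space d)) : Prop :=
  ∃ V : Set (Space d), IsOpen V ∧ s ⊆ V ∧ ∀ x ∈ V ∩ frontier Ω, IsC2BoundaryAt Ω x

/-! ### Function spaces on the boundary and the single-layer operator -/

/-- Surface measure on `∂Ω`: the `(d-1)`-dimensional Hausdorff measure, normalised to agree
with Lebesgue measure in dimension `d - 1`, restricted to `∂Ω`. -/
def surfaceMeasure {d : ℕ} (Ω : Set (Space d)) : Measure (Space d) :=
  (μHE[d - 1] : Measure (Space d)).restrict (frontier Ω)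

/-- The single-layer operator `S_k φ(x) = ∫_{∂Ω} Φ_k(x, y) φ(y) ds(y)`. -/
def singleLayer {d : ℕ} (Ω : Set (Space d)) (k : ℝ) (φ : Space d → ℂ) (x : Space d) : ℂ :=
  ∫ y, fundamentalSolution d k x y * φ y ∂(surfaceMeasure Ω)

/-- The tangent space of `∂Ω` at `x`: the span of the tangent cone. Where `∂Ω` is
differentiable, hence at almost every point of a Lipschitz boundary, the tangent cone is already
the tangent hyperplane. -/
def tangentSpan {d : ℕ} (Ω : Set (Space d)) (x : Space d) : Submodule ℝ (Space d) :=
  Submodule.span ℝ (tangentConeAt ℝ (frontier Ω) x)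

/-- The surface gradient on `∂Ω` of (the restriction of) a differentiable complex-valued function
`u` on `ℝᵈ`: the tangential part of `∇u`. Its `j`-th component is the derivative of `u` in the
direction of the tangential part of the `j`-th coordinate vector. -/
def surfaceGradient {d : ℕ} (Ω : Set (Space d)) (u : Space d → ℂ) (x : Space d) :
    EuclideanSpace ℂ (Fin d) :=
  WithLp.toLp 2 fun j =>
    fderiv ℝ u x ((tangentSpan Ω x).starProjection (EuclideanSpace.single j 1))

/-- `v ∈ L²(∂Ω)` belongs to `H¹(∂Ω)`, with surface gradient `g ∈ L²(∂Ω)`. Here `H¹(∂Ω)` is the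
completion of the restrictions to `∂Ω` of functions in `C_c^∞(ℝᵈ)` under the norm
`(∫_{∂Ω} |∇_{∂Ω} u|² + |u|² ds)^{1/2}`: there are such functions `uₙ` with `uₙ → v` and
`∇_{∂Ω} uₙ → g` in `L²(∂Ω)`. -/
def HasSurfaceGradient {d : ℕ} (Ω : Set (Space d)) (v : Space d → ℂ)
    (g : Space d → EuclideanSpace ℂ (Fin d)) : Prop :=
  MemLp v 2 (surfaceMeasure Ω) ∧ MemLp g 2 (surfaceMeasure Ω) ∧
  ∃ u : ℕ → Space d → ℂ, (∀ n, ContDiff ℝ ∞ (u n) ∧ HasCompactSupport (u n)) ∧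
    Tendsto (fun n => eLpNorm (fun x => u n x - v x) 2 (surfaceMeasure Ω)) atTop (𝓝 0) ∧
    Tendsto (fun n => eLpNorm (fun x => surfaceGradient Ω (u n) x - g x) 2 (surfaceMeasure Ω))
      atTop (𝓝 0)

/-- The `L²(∂Ω)` norm. -/
def normL2 {d : ℕ} (Ω : Set (Space d)) (v : Space d → ℂ) : ℝ≥0∞ :=
  eLpNorm v 2 (surfaceMeasure Ω)

/-- The `H¹(∂Ω)` norm `(‖v‖² + ‖∇_{∂Ω} v‖²)^{1/2}`, which is `∞` if `v ∉ H¹(∂Ω)`. The surface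
gradient is unique up to null sets, so the infimum runs over the values for one class. -/
def normH1 {d : ℕ} (Ω : Set (Space d)) (v : Space d → ℂ) : ℝ≥0∞ :=
  ⨅ (g : Space d → EuclideanSpace ℂ (Fin d)) (_ : HasSurfaceGradient Ω v g),
    (normL2 Ω v ^ 2 + eLpNorm g 2 (surfaceMeasure Ω) ^ 2) ^ (1 / 2 : ℝ)

/-- The operator norm of `T` from `L²(∂Ω)` to the space with norm `N`, as an element of
`[0, ∞]`: the supremum of `N (T φ)` over the unit ball of `L²(∂Ω)`. -/
def opNorm {d : ℕ} (Ω : Set (Space d)) (N : (Space d → ℂ) → ℝ≥0∞)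
    (T : (Space d → ℂ) → Space d → ℂ) : ℝ≥0∞ :=
  ⨆ (φ : Space d → ℂ) (_ : MemLp φ 2 (surfaceMeasure Ω)) (_ : normL2 Ω φ ≤ 1), N (T φ)

/-- The open line segment of length `2δ` with midpoint `a` and direction `e`. -/
def lineSegment {d : ℕ} (a e : Space d) (δ : ℝ) : Set (Space d) :=
  {x | ∃ t : ℝ, |t| < δ ∧ x = a + t • e}

end Helmholtz

end

/-!
Let `φ` be the plane wave `e^{iκ e·y}`, `κ = ±k`, restricted to a piece of `∂Ω` along the segment
and normalised in `L²(∂Ω)`. At points `x` of a neighbouring piece further along the segment,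
`S_k φ (x) = e^{iκ e·x} A (x)`, where the phase of the fundamental solution is cancelled in `A`.
Once `Re (ζ A)`, for some unimodular constant `ζ`, is bounded below on that piece, so is the `L²`
norm of `S_k φ`. For the `H¹` norm, the tangential derivative of `S_k φ` along the segment is paired
with the plane wave `e^{-iκ e·x}` times a cutoff. Integration by parts moves the derivative onto the
plane wave and produces the factor `κ` that makes up the difference between the two bounds.

If `d = 2`, the pieces lie in the segment itself and have fixed length. The function `√t H₀⁽¹⁾(t)`
solves `u'' + (1 + 1 / (4 t²)) u = 0`, so that it is asymptotic to a combination of `e^{it}` and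
`e^{-it}`, and an energy estimate excludes that both coefficients vanish. One chooses the sign of
`κ` that cancels a wave with nonzero coefficient; the other one oscillates and averages out, and
`A` has the order `k^{-1/2}` of `H₀⁽¹⁾(kr)`.

If `d = 3`, the pieces are strips of fixed length and of width comparable to `k^{-1/2}` around the
segment. For `x` and `y` in these strips `k (|x - y| - e·(x - y)) ≤ 1`, because the deviation from
the direction `e` enters quadratically, so that `A` is comparable to the area of the strip.
-/

noncomputable section

namespace Helmholtz

/-! ### Power series with factorially decaying coefficients -/

/-- The coefficients `c` are bounded by a multiple of those of the exponential series, which makes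
the power series entire. -/
def HasFactorialDecay (c : ℕ → ℝ) : Prop := ∃ K : ℝ, ∀ m, |c m| ≤ K / m.factorial

/-- The sum of the power series with coefficients `c`. -/
def powSum (c : ℕ → ℝ) (z : ℝ) : ℝ := ∑' m, c m * z ^ m

/-- The coefficients of the derivative of the power series with coefficients `c`. -/
def derivCoeff (c : ℕ → ℝ) (m : ℕ) : ℝ := (m + 1) * c (m + 1)

section PowerSeries

variable {b c : ℕ → ℝ}

lemma HasFactorialDecay.summable (hc : HasFactorialDecay c) (z : ℝ) :
    Summable fun m => c m * z ^ m := by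
  obtain ⟨K, hK⟩ := hc
  refine .of_norm_bounded ((Real.summable_pow_div_factorial |z|).mul_left K) fun m => ?_
  rw [Real.norm_eq_abs, abs_mul, abs_pow]
  calc |c m| * |z| ^ m ≤ K / m.factorial * |z| ^ m := by gcongr; exact hK m
    _ = K * (|z| ^ m / m.factorial) := by ring

lemma HasFactorialDecay.derivCoeff (hc : HasFactorialDecay c) :
    HasFactorialDecay (derivCoeff c) := by
  obtain ⟨K, hK⟩ := hc
  refine ⟨K, fun m => ?_⟩
  have hm : (0 : ℝ) < m + 1 := by positivity
  rw [Helmholtz.derivCoeff, abs_mul, abs_of_pos hm]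
  calc ((m : ℝ) + 1) * |c (m + 1)| ≤ (m + 1) * (K / (m + 1).factorial) := by gcongr; exact hK _
    _ = K / m.factorial := by
      rw [Nat.factorial_succ]
      push_cast
      field_simp

lemma HasFactorialDecay.summable_mul_pow_pred (hc : HasFactorialDecay c) (z : ℝ) :
    Summable fun m : ℕ => c m * (m * z ^ (m - 1)) := by
  rw [← summable_nat_add_iff 1]
  refine (hc.derivCoeff.summable z).congr fun m => ?_
  rw [Nat.add_sub_cancel, Helmholtz.derivCoeff]
  push_cast
  ring

lemma HasFactorialDecay.tsum_mul_pow_pred (hc : HasFactorialDecay c) (z : ℝ) :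
    ∑' m : ℕ, c m * (m * z ^ (m - 1)) = powSum (Helmholtz.derivCoeff c) z := by
  rw [(hc.summable_mul_pow_pred z).tsum_eq_zero_add, powSum, Nat.cast_zero, zero_mul, mul_zero,
    zero_add]
  refine tsum_congr fun m => ?_
  rw [Nat.add_sub_cancel, Helmholtz.derivCoeff]
  push_cast
  ring

lemma HasFactorialDecay.hasDerivAt_powSum (hc : HasFactorialDecay c) (z : ℝ) :
    HasDerivAt (powSum c) (powSum (Helmholtz.derivCoeff c) z) z := by
  have ⟨K, hK⟩ := hc
  have hdecay : HasFactorialDecay fun m => K / m.factorial := ⟨|K|, fun m => by simp [abs_div]⟩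
  have hz : z ∈ Ioo (-(|z| + 1)) (|z| + 1) := abs_lt.1 (lt_add_one _)
  refine (hasDerivAt_tsum_of_isPreconnected (hdecay.summable_mul_pow_pred (|z| + 1)) isOpen_Ioo
    isPreconnected_Ioo (fun m y _ => (hasDerivAt_pow m y).const_mul (c m)) (fun m y hy => ?_) hz
    (hc.summable z) hz).congr_deriv (hc.tsum_mul_pow_pred z)
  rw [Real.norm_eq_abs, abs_mul, abs_mul, abs_pow, Nat.abs_cast]
  have hy' : |y| ≤ |z| + 1 := (abs_lt.2 hy).le
  have hK' := (abs_nonneg _).trans (hK m)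
  gcongr
  exact hK m

/-- For `b = 0`, this is Bessel's equation in the variable `z = t² / 4`. -/
lemma powSum_ode (hc : HasFactorialDecay c)
    (h : ∀ m : ℕ, (m + 1 : ℝ) ^ 2 * c (m + 1) = b m - c m) (z : ℝ) :
    z * powSum (derivCoeff (derivCoeff c)) z + powSum (derivCoeff c) z + powSum c z
      = powSum b z := by
  rw [← hc.derivCoeff.tsum_mul_pow_pred z, powSum, powSum, powSum, ← tsum_mul_left,
    ← ((hc.derivCoeff.summable_mul_pow_pred z).mul_left z).tsum_add (hc.derivCoeff.summable z),
    ← (((hc.derivCoeff.summable_mul_pow_pred z).mul_left z).add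
      (hc.derivCoeff.summable z)).tsum_add (hc.summable z)]
  refine tsum_congr fun m => ?_
  rcases m with _ | m
  · linear_combination (norm := (simp only [derivCoeff]; push_cast; ring)) h 0
  · have := h (m + 1)
    simp only [derivCoeff, Nat.add_sub_cancel] at this ⊢
    push_cast at this ⊢
    linear_combination z ^ (m + 1) * this

lemma HasFactorialDecay.hasDerivAt_powSum_sq (hc : HasFactorialDecay c) (t : ℝ) :
    HasDerivAt (fun t => powSum c (t ^ 2 / 4))
      (t / 2 * powSum (Helmholtz.derivCoeff c) (t ^ 2 / 4)) t := by
  refine ((hc.hasDerivAt_powSum (t ^ 2 / 4)).comp t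
    ((hasDerivAt_pow 2 t).div_const 4)).congr_deriv ?_
  push_cast
  ring

lemma HasFactorialDecay.hasDerivAt_half_mul_powSum_sq (hc : HasFactorialDecay c) (t : ℝ) :
    HasDerivAt (fun t => t / 2 * powSum c (t ^ 2 / 4))
      (1 / 2 * powSum c (t ^ 2 / 4)
        + t ^ 2 / 4 * powSum (Helmholtz.derivCoeff c) (t ^ 2 / 4)) t := by
  refine (((hasDerivAt_id t).div_const 2).mul (hc.hasDerivAt_powSum_sq t)).congr_deriv ?_
  simp only [id_eq]
  ring

end PowerSeries

/-! ### The Bessel differential equation -/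

/-- The coefficients of `J₀` as a power series in `t² / 4`. -/
def coeffJ (m : ℕ) : ℝ := (-1) ^ m / (m.factorial : ℝ) ^ 2

/-- The coefficients of the logarithm-free part of `Y₀`, up to the factor `-2/π`, as a power series
in `t² / 4`. -/
def coeffY (m : ℕ) : ℝ := (-1) ^ m * (harmonic m : ℝ) / (m.factorial : ℝ) ^ 2

lemma harmonic_nonneg (m : ℕ) : 0 ≤ harmonic m :=
  Finset.sum_nonneg fun _ _ => by positivity

lemma harmonic_le_factorial (m : ℕ) : harmonic m ≤ m.factorial := by
  have h : harmonic m ≤ ∑ _i ∈ Finset.range m, (1 : ℚ) :=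
    Finset.sum_le_sum fun i _ => inv_le_one_of_one_le₀ (by simp)
  refine h.trans ?_
  rw [Finset.sum_const, Finset.card_range, nsmul_one]
  exact_mod_cast m.self_le_factorial

lemma hasFactorialDecay_coeffJ : HasFactorialDecay coeffJ := by
  refine ⟨1, fun m => ?_⟩
  have h1 : (1 : ℝ) ≤ m.factorial := by exact_mod_cast m.factorial_pos
  rw [coeffJ, abs_div, abs_pow, abs_neg, abs_one, one_pow, abs_of_nonneg (by positivity)]
  exact one_div_le_one_div_of_le (by positivity) (le_self_pow₀ h1 two_ne_zero)

lemma hasFactorialDecay_coeffY : HasFactorialDecay coeffY := by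
  refine ⟨1, fun m => ?_⟩
  have h0 : (0 : ℝ) < m.factorial := by exact_mod_cast m.factorial_pos
  have h1 : (harmonic m : ℝ) ≤ m.factorial := by exact_mod_cast harmonic_le_factorial m
  rw [coeffY, abs_div, abs_mul, abs_pow, abs_neg, abs_one, one_pow, one_mul,
    abs_of_nonneg (by exact_mod_cast harmonic_nonneg m), abs_of_pos (by positivity),
    div_le_div_iff₀ (by positivity) h0]
  nlinarith

lemma sq_succ_mul_coeffJ (m : ℕ) : (m + 1 : ℝ) ^ 2 * coeffJ (m + 1) = -coeffJ m := by
  rw [coeffJ, coeffJ, Nat.factorial_succ]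
  push_cast
  field_simp
  ring

lemma sq_succ_mul_coeffY (m : ℕ) :
    (m + 1 : ℝ) ^ 2 * coeffY (m + 1) = derivCoeff coeffJ m - coeffY m := by
  rw [coeffY, coeffY, derivCoeff, coeffJ, Nat.factorial_succ, harmonic_succ]
  push_cast
  field_simp
  ring

lemma powSum_coeffJ_ode (z : ℝ) :
    z * powSum (derivCoeff (derivCoeff coeffJ)) z + powSum (derivCoeff coeffJ) z
      + powSum coeffJ z = 0 := by
  rw [powSum_ode (b := 0) hasFactorialDecay_coeffJ
    fun m => by rw [sq_succ_mul_coeffJ, Pi.zero_apply, zero_sub]]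
  simp [powSum]

lemma powSum_coeffY_ode (z : ℝ) :
    z * powSum (derivCoeff (derivCoeff coeffY)) z + powSum (derivCoeff coeffY) z
      + powSum coeffY z = powSum (derivCoeff coeffJ) z :=
  powSum_ode hasFactorialDecay_coeffY sq_succ_mul_coeffY z

lemma besselJ0_eq (t : ℝ) : besselJ0 t = powSum coeffJ (t ^ 2 / 4) :=
  tsum_congr fun m => by rw [coeffJ]; ring

lemma besselY0_eq (t : ℝ) : besselY0 t = 2 / Real.pi *
    ((Real.log (t / 2) + Real.eulerMascheroniConstant) * powSum coeffJ (t ^ 2 / 4)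
      - powSum coeffY (t ^ 2 / 4)) := by
  have hY : ∑' m : ℕ, (-1) ^ m * (harmonic m : ℝ) * (t ^ 2 / 4) ^ m / (m.factorial : ℝ) ^ 2
      = powSum coeffY (t ^ 2 / 4) := tsum_congr fun m => by rw [coeffY]; ring
  rw [besselY0, besselJ0_eq, hY]
  ring

/-- The derivative of `J₀`. -/
def besselJ0Deriv (t : ℝ) : ℝ := t / 2 * powSum (derivCoeff coeffJ) (t ^ 2 / 4)

/-- The derivative of `Y₀` on `(0, ∞)`. -/
def besselY0Deriv (t : ℝ) : ℝ :=
  2 / Real.pi * (t⁻¹ * powSum coeffJ (t ^ 2 / 4)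
      + (Real.log (t / 2) + Real.eulerMascheroniConstant) *
        (t / 2 * powSum (derivCoeff coeffJ) (t ^ 2 / 4))
      - t / 2 * powSum (derivCoeff coeffY) (t ^ 2 / 4))

lemma hasDerivAt_log_half_add {t : ℝ} (ht : t ≠ 0) (C : ℝ) :
    HasDerivAt (fun t => Real.log (t / 2) + C) t⁻¹ t := by
  refine ((((hasDerivAt_id t).div_const 2).log (by simpa using ht)).add_const C).congr_deriv ?_
  simp only [id_eq]
  field_simp

lemma hasDerivAt_besselJ0 (t : ℝ) : HasDerivAt besselJ0 (besselJ0Deriv t) t := by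
  rw [funext besselJ0_eq]
  exact hasFactorialDecay_coeffJ.hasDerivAt_powSum_sq t

lemma hasDerivAt_besselY0 {t : ℝ} (ht : t ≠ 0) : HasDerivAt besselY0 (besselY0Deriv t) t := by
  rw [funext besselY0_eq]
  exact (((hasDerivAt_log_half_add ht _).mul (hasFactorialDecay_coeffJ.hasDerivAt_powSum_sq t)).sub
    (hasFactorialDecay_coeffY.hasDerivAt_powSum_sq t)).const_mul _

lemma besselJ0_ode {t : ℝ} (ht : t ≠ 0) :
    HasDerivAt besselJ0Deriv (-besselJ0 t - besselJ0Deriv t / t) t := by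
  refine (hasFactorialDecay_coeffJ.derivCoeff.hasDerivAt_half_mul_powSum_sq t).congr_deriv ?_
  rw [besselJ0_eq, besselJ0Deriv]
  field_simp
  linear_combination 8 * powSum_coeffJ_ode (t ^ 2 / 4)

lemma besselY0_ode {t : ℝ} (ht : t ≠ 0) :
    HasDerivAt besselY0Deriv (-besselY0 t - besselY0Deriv t / t) t := by
  have hinv := (hasDerivAt_inv ht).mul (hasFactorialDecay_coeffJ.hasDerivAt_powSum_sq t)
  have hlog := (hasDerivAt_log_half_add ht Real.eulerMascheroniConstant).mul
    (hasFactorialDecay_coeffJ.derivCoeff.hasDerivAt_half_mul_powSum_sq t)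
  have hY := hasFactorialDecay_coeffY.derivCoeff.hasDerivAt_half_mul_powSum_sq t
  refine (((hinv.add hlog).sub hY).const_mul (2 / Real.pi)).congr_deriv ?_
  rw [besselY0_eq, besselY0Deriv]
  generalize Real.log (t / 2) + Real.eulerMascheroniConstant = ℓ
  have hπ := Real.pi_ne_zero
  field_simp
  linear_combination 8 * t ^ 2 * ℓ * powSum_coeffJ_ode (t ^ 2 / 4)
    - 8 * t ^ 2 * powSum_coeffY_ode (t ^ 2 / 4)

/-- The derivative of `H₀⁽¹⁾` on `(0, ∞)`. -/
def hankelDeriv (t : ℝ) : ℂ := (besselJ0Deriv t : ℂ) + Complex.I * (besselY0Deriv t : ℂ)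

lemma hasDerivAt_hankelH0 {t : ℝ} (ht : t ≠ 0) : HasDerivAt hankelH0 (hankelDeriv t) t :=
  (hasDerivAt_besselJ0 t).ofReal_comp.add
    ((hasDerivAt_besselY0 ht).ofReal_comp.const_mul Complex.I)

lemma hankelH0_ode {t : ℝ} (ht : t ≠ 0) :
    HasDerivAt hankelDeriv (-hankelH0 t - hankelDeriv t / t) t := by
  refine ((besselJ0_ode ht).ofReal_comp.add
    ((besselY0_ode ht).ofReal_comp.const_mul Complex.I)).congr_deriv ?_
  rw [hankelH0, hankelDeriv]
  push_cast
  ring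

lemma exists_hankelH0_ne_zero : ∃ t > 0, hankelH0 t ≠ 0 := by
  have h0 : besselJ0 0 = 1 := by
    rw [besselJ0, tsum_eq_single 0 (fun m hm => by simp [hm])]
    simp
  have hpos : ∀ᶠ t in 𝓝[>] (0 : ℝ), 0 < besselJ0 t :=
    ((hasDerivAt_besselJ0 0).continuousAt.eventually
      (lt_mem_nhds (h0 ▸ one_pos))).filter_mono nhdsWithin_le_nhds
  obtain ⟨t, ht, ht0⟩ := (hpos.and self_mem_nhdsWithin).exists
  refine ⟨t, ht0, fun h => ht.ne' ?_⟩
  simpa [hankelH0] using congrArg Complex.re h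

/-! ### Asymptotics at infinity of perturbed oscillators -/

lemma mul_exp_le_and_le_mul_exp_of_abs_deriv_le {f f' : ℝ → ℝ} {c t₀ t : ℝ} (ht₀ : 0 < t₀)
    (hf : ∀ t ≥ t₀, HasDerivAt f (f' t) t) (hf' : ∀ t ≥ t₀, |f' t| ≤ c / t ^ 2 * f t)
    (hc : 0 ≤ c) (hf0 : ∀ t ≥ t₀, 0 ≤ f t) (ht : t₀ ≤ t) :
    f t₀ * Real.exp (-c / t₀) ≤ f t ∧ f t ≤ f t₀ * Real.exp (c / t₀) := by
  have hpos : ∀ t ≥ t₀, 0 < t := fun t ht => ht₀.trans_le ht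
  have hd : ∀ b : ℝ, ∀ t ≥ t₀, HasDerivAt (fun t => f t * Real.exp (b / t))
      ((f' t - b / t ^ 2 * f t) * Real.exp (b / t)) t := fun b t ht => by
    refine ((hf t ht).mul (((hasDerivAt_inv (hpos t ht).ne').const_mul b).exp)).congr_deriv ?_
    rw [div_eq_mul_inv b t]
    ring
  have hcont : ∀ b, ContinuousOn (fun t => f t * Real.exp (b / t)) (Ici t₀) := fun b t ht =>
    (hd b t ht).continuousAt.continuousWithinAt
  have hderiv : ∀ b, ∀ t ∈ interior (Ici t₀), HasDerivWithinAt (fun t => f t * Real.exp (b / t))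
      ((f' t - b / t ^ 2 * f t) * Real.exp (b / t)) (interior (Ici t₀)) t := fun b t ht =>
    (hd b t (interior_subset ht)).hasDerivWithinAt
  have hanti : AntitoneOn (fun t => f t * Real.exp (c / t)) (Ici t₀) :=
    antitoneOn_of_hasDerivWithinAt_nonpos (convex_Ici t₀) (hcont c) (hderiv c) fun t ht =>
      mul_nonpos_of_nonpos_of_nonneg
        (sub_nonpos.2 (abs_le.1 (hf' t (interior_subset ht))).2) (Real.exp_pos _).le
  have hmono : MonotoneOn (fun t => f t * Real.exp (-c / t)) (Ici t₀) :=
    monotoneOn_of_hasDerivWithinAt_nonneg (convex_Ici t₀) (hcont (-c)) (hderiv (-c)) fun t ht => by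
      refine mul_nonneg ?_ (Real.exp_pos _).le
      rw [neg_div, neg_mul, sub_neg_eq_add]
      linarith [(abs_le.1 (hf' t (interior_subset ht))).1]
  have hct : 0 ≤ c / t := div_nonneg hc (hpos t ht).le
  refine ⟨(hmono self_mem_Ici ht ht).trans (mul_le_of_le_one_right (hf0 t ht) ?_),
    (le_mul_of_one_le_right (hf0 t ht) ?_).trans (hanti self_mem_Ici ht ht)⟩
  · rw [Real.exp_le_one_iff, neg_div]
    exact neg_nonpos.2 hct
  · exact Real.one_le_exp hct

lemma exists_tendsto_of_norm_deriv_le_inv_sq {E : Type*} [NormedAddCommGroup E] [NormedSpace ℝ E]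
    [CompleteSpace E] {f f' : ℝ → E} {a C : ℝ} (ha : 0 < a)
    (hf : ∀ t ≥ a, HasDerivAt f (f' t) t) (hc : ContinuousOn f' (Ici a))
    (hb : ∀ t ≥ a, ‖f' t‖ ≤ C / t ^ 2) : ∃ A, Tendsto f atTop (𝓝 A) := by
  refine ⟨_, tendsto_limUnder_of_hasDerivAt_of_integrableOn_Ioi (a := a) (f' := f')
    (fun t ht => hf t (le_of_lt ht)) ?_⟩
  refine Integrable.mono'
    ((integrableOn_Ioi_rpow_of_lt (by norm_num : (-2 : ℝ) < -1) ha).const_mul C)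
    ((hc.mono Ioi_subset_Ici_self).aestronglyMeasurable measurableSet_Ioi) ?_
  filter_upwards [ae_restrict_mem measurableSet_Ioi] with t ht
  refine (hb t (le_of_lt ht)).trans_eq ?_
  rw [Real.rpow_neg (ha.trans ht).le, Real.rpow_two, div_eq_mul_inv]

/-- `u` solves the equation `u'' + (1 + V) u = 0` on `[t₀, ∞)`, where `u'` is the derivative of `u`
and the perturbation satisfies `|V t| ≤ c / t²`. -/
structure IsPerturbedOscillator (V u u' : ℝ → ℂ) (c t₀ : ℝ) : Prop where
  pos : 0 < t₀
  continuousOn_potential : ContinuousOn V (Ici t₀)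
  norm_potential_le : ∀ t ≥ t₀, ‖V t‖ ≤ c / t ^ 2
  hasDerivAt : ∀ t ≥ t₀, HasDerivAt u (u' t) t
  hasDerivAt_deriv : ∀ t ≥ t₀, HasDerivAt u' (-(1 + V t) * u t) t

/-- For `s = ±1`, the coefficient of `e^{ist}` when the data `(u t, u' t)` are matched with those
of a combination of `e^{it}` and `e^{-it}` (variation of constants). -/
def waveAmplitude (u u' : ℝ → ℂ) (s t : ℝ) : ℂ :=
  Complex.exp ((-(s * t) : ℝ) * Complex.I) * (u t - s * Complex.I * u' t) / 2

section Oscillator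

variable {V u u' : ℝ → ℂ} {c t₀ s t : ℝ}

lemma mul_exp_eq_waveAmplitude_add (u u' : ℝ → ℂ) (s t : ℝ) :
    u t * Complex.exp ((-(s * t) : ℝ) * Complex.I)
      = waveAmplitude u u' s t
        + waveAmplitude u u' (-s) t * Complex.exp ((-(2 * s * t) : ℝ) * Complex.I) := by
  have hexp : Complex.exp ((-(-s * t) : ℝ) * Complex.I)
      * Complex.exp ((-(2 * s * t) : ℝ) * Complex.I)
        = Complex.exp ((-(s * t) : ℝ) * Complex.I) := by
    rw [← Complex.exp_add]
    congr 1
    push_cast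
    ring
  simp only [waveAmplitude, Complex.ofReal_neg s]
  linear_combination (-(u t + s * Complex.I * u' t) / 2) * hexp

lemma norm_waveAmplitude_sq_add (u u' : ℝ → ℂ) (hs : s ^ 2 = 1) (t : ℝ) :
    ‖waveAmplitude u u' s t‖ ^ 2 + ‖waveAmplitude u u' (-s) t‖ ^ 2
      = (‖u t‖ ^ 2 + ‖u' t‖ ^ 2) / 2 := by
  have hnorm : ‖(s : ℂ) * Complex.I * u' t‖ ^ 2 = ‖u' t‖ ^ 2 := by
    rw [norm_mul, norm_mul, Complex.norm_I, Complex.norm_real, Real.norm_eq_abs, mul_one, mul_pow,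
      sq_abs, hs, one_mul]
  have hamp : ∀ s : ℝ, ‖waveAmplitude u u' s t‖ = ‖u t - s * Complex.I * u' t‖ / 2 := fun s => by
    rw [waveAmplitude, norm_div, norm_mul, Complex.norm_exp_ofReal_mul_I, one_mul,
      Complex.norm_ofNat]
  rw [hamp, hamp, Complex.ofReal_neg, neg_mul, neg_mul, sub_neg_eq_add]
  have := parallelogram_law_with_norm ℝ (u t) (s * Complex.I * u' t)
  linear_combination this / 4 + hnorm / 2

namespace IsPerturbedOscillator

lemma bound_nonneg (h : IsPerturbedOscillator V u u' c t₀) : 0 ≤ c := by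
  have := (norm_nonneg _).trans (h.norm_potential_le t₀ le_rfl)
  rwa [le_div_iff₀ (pow_pos h.pos 2), zero_mul] at this

lemma hasDerivAt_energy (h : IsPerturbedOscillator V u u' c t₀) (ht : t₀ ≤ t) :
    HasDerivAt (fun t => ‖u t‖ ^ 2 + ‖u' t‖ ^ 2) (-2 * ⟪u' t, V t * u t⟫) t := by
  refine ((h.hasDerivAt t ht).norm_sq.add (h.hasDerivAt_deriv t ht).norm_sq).congr_deriv ?_
  rw [neg_mul, one_add_mul, inner_neg_right, inner_add_right, real_inner_comm (u' t)]
  ring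

lemma abs_energy_deriv_le (h : IsPerturbedOscillator V u u' c t₀) (ht : t₀ ≤ t) :
    |-2 * ⟪u' t, V t * u t⟫| ≤ c / t ^ 2 * (‖u t‖ ^ 2 + ‖u' t‖ ^ 2) := by
  rw [abs_mul, abs_neg, abs_two]
  calc 2 * |⟪u' t, V t * u t⟫| ≤ 2 * (‖u' t‖ * (‖V t‖ * ‖u t‖)) := by
        gcongr
        exact (abs_real_inner_le_norm _ _).trans_eq (by rw [norm_mul])
    _ = ‖V t‖ * (2 * ‖u t‖ * ‖u' t‖) := by ring
    _ ≤ c / t ^ 2 * (‖u t‖ ^ 2 + ‖u' t‖ ^ 2) := by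
        have := h.norm_potential_le t ht
        have hle : 2 * ‖u t‖ * ‖u' t‖ ≤ ‖u t‖ ^ 2 + ‖u' t‖ ^ 2 := two_mul_le_add_sq _ _
        have hc := h.bound_nonneg
        gcongr

lemma energy_bounds (h : IsPerturbedOscillator V u u' c t₀) (ht : t₀ ≤ t) :
    (‖u t₀‖ ^ 2 + ‖u' t₀‖ ^ 2) * Real.exp (-c / t₀) ≤ ‖u t‖ ^ 2 + ‖u' t‖ ^ 2 ∧
      ‖u t‖ ^ 2 + ‖u' t‖ ^ 2 ≤ (‖u t₀‖ ^ 2 + ‖u' t₀‖ ^ 2) * Real.exp (c / t₀) :=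
  mul_exp_le_and_le_mul_exp_of_abs_deriv_le h.pos (fun _ ht => h.hasDerivAt_energy ht)
    (fun _ ht => h.abs_energy_deriv_le ht) h.bound_nonneg (fun _ _ => by positivity) ht

lemma hasDerivAt_waveAmplitude (h : IsPerturbedOscillator V u u' c t₀) (hs : s ^ 2 = 1)
    (ht : t₀ ≤ t) : HasDerivAt (waveAmplitude u u' s)
      (Complex.exp ((-(s * t) : ℝ) * Complex.I) * (s * Complex.I * V t * u t) / 2) t := by
  have hexp : HasDerivAt (fun t : ℝ => ((-(s * t) : ℝ) : ℂ) * Complex.I) (-s * Complex.I) t := by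
    simpa using (((hasDerivAt_id t).const_mul s).neg.ofReal_comp.mul_const Complex.I)
  refine ((hexp.cexp.mul ((h.hasDerivAt t ht).sub ((h.hasDerivAt_deriv t ht).const_mul
    (s * Complex.I)))).div_const 2).congr_deriv ?_
  have hs' : (s : ℂ) ^ 2 = 1 := by exact_mod_cast hs
  simp only [Pi.sub_apply]
  linear_combination (Complex.exp ((-(s * t) : ℝ) * Complex.I) * u' t / 2) *
    (Complex.I ^ 2 * hs' + Complex.I_sq)

lemma exists_tendsto_waveAmplitude (h : IsPerturbedOscillator V u u' c t₀) (hs : s ^ 2 = 1) :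
    ∃ D, Tendsto (waveAmplitude u u' s) atTop (𝓝 D) := by
  set M := √((‖u t₀‖ ^ 2 + ‖u' t₀‖ ^ 2) * Real.exp (c / t₀))
  refine exists_tendsto_of_norm_deriv_le_inv_sq (C := c * M / 2) h.pos
    (fun t ht => h.hasDerivAt_waveAmplitude hs ht) ?_ fun t ht => ?_
  · have hu : ContinuousOn u (Ici t₀) := fun t ht =>
      (h.hasDerivAt t ht).continuousAt.continuousWithinAt
    have hV := h.continuousOn_potential
    fun_prop
  · have hu : ‖u t‖ ≤ M := Real.le_sqrt_of_sq_le
      ((le_add_of_nonneg_right (sq_nonneg ‖u' t‖)).trans (h.energy_bounds ht).2)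
    have hV := h.norm_potential_le t ht
    have hs1 : |s| = 1 := by rw [← Real.sqrt_sq_eq_abs, hs, Real.sqrt_one]
    rw [norm_div, norm_mul, norm_mul, norm_mul, norm_mul, Complex.norm_exp_ofReal_mul_I,
      Complex.norm_real, Complex.norm_I, Real.norm_eq_abs, hs1, Complex.norm_ofNat, one_mul,
      one_mul, one_mul]
    have hc := h.bound_nonneg
    calc ‖V t‖ * ‖u t‖ / 2 ≤ c / t ^ 2 * M / 2 := by gcongr
      _ = c * M / 2 / t ^ 2 := by ring

/-- The energy estimate keeps the two amplitudes from vanishing simultaneously at infinity. -/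
theorem exists_modulated_asymptotics (h : IsPerturbedOscillator V u u' c t₀) (hne : u t₀ ≠ 0) :
    ∃ (s : ℝ) (D D' : ℂ), s ^ 2 = 1 ∧ D ≠ 0 ∧
      Tendsto (fun t : ℝ => u t * Complex.exp ((-(s * t) : ℝ) * Complex.I)
        - D - D' * Complex.exp ((-(2 * s * t) : ℝ) * Complex.I)) atTop (𝓝 0) := by
  have hlim : ∀ {s : ℝ} {D D' : ℂ}, Tendsto (waveAmplitude u u' s) atTop (𝓝 D) →
      Tendsto (waveAmplitude u u' (-s)) atTop (𝓝 D') →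
      Tendsto (fun t : ℝ => u t * Complex.exp ((-(s * t) : ℝ) * Complex.I)
        - D - D' * Complex.exp ((-(2 * s * t) : ℝ) * Complex.I)) atTop (𝓝 0) := by
    intro s D D' hD hD'
    have hsum := (tendsto_iff_norm_sub_tendsto_zero.1 hD).add
      (tendsto_iff_norm_sub_tendsto_zero.1 hD')
    rw [add_zero] at hsum
    refine squeeze_zero_norm (fun t => ?_) hsum
    rw [mul_exp_eq_waveAmplitude_add u u' s t, add_sub_right_comm, add_sub_assoc, ← sub_mul]
    refine (norm_add_le _ _).trans_eq ?_
    rw [norm_mul, Complex.norm_exp_ofReal_mul_I, mul_one]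
  obtain ⟨A, hA⟩ := h.exists_tendsto_waveAmplitude (one_pow 2)
  obtain ⟨B, hB⟩ := h.exists_tendsto_waveAmplitude (neg_one_sq (R := ℝ))
  by_cases hA0 : A = 0
  · refine ⟨-1, B, A, neg_one_sq, fun hB0 => ?_, hlim hB (by rwa [neg_neg])⟩
    have hpos : 0 < (‖u t₀‖ ^ 2 + ‖u' t₀‖ ^ 2) * Real.exp (-c / t₀) := by positivity
    have hle : (‖u t₀‖ ^ 2 + ‖u' t₀‖ ^ 2) * Real.exp (-c / t₀) / 2 ≤ ‖A‖ ^ 2 + ‖B‖ ^ 2 := by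
      refine ge_of_tendsto ((hA.norm.pow 2).add (hB.norm.pow 2)) ?_
      filter_upwards [eventually_ge_atTop t₀] with t ht
      rw [norm_waveAmplitude_sq_add u u' (one_pow 2)]
      gcongr
      exact (h.energy_bounds ht).1
    rw [hA0, hB0, norm_zero] at hle
    linarith
  · exact ⟨1, A, B, one_pow 2, hA0, hlim hA hB⟩

end IsPerturbedOscillator

end Oscillator

/-- The substitution `u = √t H₀⁽¹⁾` removes the first-order term of Bessel's equation. -/
lemma isPerturbedOscillator_sqrt_mul_hankelH0 {t₀ : ℝ} (ht₀ : 0 < t₀) :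
    IsPerturbedOscillator (fun t => 1 / (4 * (t : ℂ) ^ 2)) (fun t => (√t : ℂ) * hankelH0 t)
      (fun t => (1 / (2 * √t) : ℝ) * hankelH0 t + (√t : ℂ) * hankelDeriv t) (1 / 4) t₀ where
  pos := ht₀
  continuousOn_potential := by
    refine continuousOn_const.div (by fun_prop) fun t ht => ?_
    have : (t : ℂ) ≠ 0 := by exact_mod_cast (ht₀.trans_le ht).ne'
    simpa using this
  norm_potential_le t _ := by
    simp only [one_div, norm_inv, norm_mul, Complex.norm_ofNat, norm_pow, Complex.norm_real,
      Real.norm_eq_abs, sq_abs]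
    exact le_of_eq (by ring)
  hasDerivAt t ht :=
    have ht0 : t ≠ 0 := (ht₀.trans_le ht).ne'
    (Real.hasDerivAt_sqrt ht0).ofReal_comp.mul (hasDerivAt_hankelH0 ht0)
  hasDerivAt_deriv t ht := by
    have ht0 : 0 < t := ht₀.trans_le ht
    have hsqrt := Real.hasDerivAt_sqrt ht0.ne'
    have hinv : HasDerivAt (fun t => 1 / (2 * √t)) _ t :=
      (hasDerivAt_const t 1).fun_div (hsqrt.const_mul 2) (by positivity)
    refine ((hinv.ofReal_comp.mul (hasDerivAt_hankelH0 ht0.ne')).add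
      (hsqrt.ofReal_comp.mul (hankelH0_ode ht0.ne'))).congr_deriv ?_
    have hsq : (t : ℂ) = (√t : ℂ) ^ 2 := by rw [← Complex.ofReal_pow, Real.sq_sqrt ht0.le]
    have hne : (√t : ℂ) ≠ 0 := by exact_mod_cast (Real.sqrt_pos.2 ht0).ne'
    push_cast
    rw [hsq]
    field_simp
    ring

lemma exists_hankelH0_modulated_asymptotics : ∃ (s : ℝ) (D D' : ℂ), s ^ 2 = 1 ∧ D ≠ 0 ∧
    Tendsto (fun t : ℝ => (√t : ℂ) * hankelH0 t * Complex.exp ((-(s * t) : ℝ) * Complex.I)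
      - D - D' * Complex.exp ((-(2 * s * t) : ℝ) * Complex.I)) atTop (𝓝 0) := by
  obtain ⟨t₀, ht₀, hne⟩ := exists_hankelH0_ne_zero
  exact (isPerturbedOscillator_sqrt_mul_hankelH0 ht₀).exists_modulated_asymptotics
    (mul_ne_zero (by simpa using (Real.sqrt_pos.2 ht₀).ne') hne)

/-! ### Integrals of the Hankel function against plane waves -/

lemma hasDerivAt_exp_mul_I {b : ℝ} (hb : b ≠ 0) (r : ℝ) :
    HasDerivAt (fun r : ℝ => Complex.exp ((b * r : ℝ) * Complex.I) / (b * Complex.I))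
      (Complex.exp ((b * r : ℝ) * Complex.I)) r := by
  have hlin : HasDerivAt (fun r : ℝ => ((b * r : ℝ) : ℂ) * Complex.I) (b * Complex.I) r := by
    simpa using ((hasDerivAt_id r).const_mul b).ofReal_comp.mul_const Complex.I
  have hbI : (b : ℂ) * Complex.I ≠ 0 := mul_ne_zero (by exact_mod_cast hb) Complex.I_ne_zero
  exact (hlin.cexp.div_const _).congr_deriv (mul_div_cancel_right₀ _ hbI)

lemma norm_integral_mul_exp_le {f f' : ℝ → ℝ} {l m b : ℝ} (hlm : l ≤ m) (hb : b ≠ 0)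
    (hf : ∀ r ∈ Icc l m, HasDerivAt f (f' r) r) (hf' : ∀ r ∈ Icc l m, f' r ≤ 0) (hm : 0 ≤ f m) :
    ‖∫ r in l..m, (f r : ℂ) * Complex.exp ((b * r : ℝ) * Complex.I)‖ ≤ 2 * f l / |b| := by
  have hu : uIcc l m = Icc l m := uIcc_of_le hlm
  have hcont : ContinuousOn f (Icc l m) := fun r hr => (hf r hr).continuousAt.continuousWithinAt
  have hint : IntervalIntegrable f' volume l m := by
    simpa using (intervalIntegral.intervalIntegrable_deriv_of_nonneg (g := -f) (g' := -f')
      (hu ▸ hcont.neg) (fun r hr => (hf r (hu ▸ Ioo_subset_Icc_self hr)).neg)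
      (fun r hr => neg_nonneg.2 (hf' r (hu ▸ Ioo_subset_Icc_self hr)))).neg
  have hlm' : f m ≤ f l := antitoneOn_of_hasDerivWithinAt_nonpos (convex_Icc l m) hcont
    (fun r hr => (hf r (interior_subset hr)).hasDerivWithinAt)
    (fun r hr => hf' r (interior_subset hr)) (left_mem_Icc.2 hlm) (right_mem_Icc.2 hlm) hlm
  set g : ℝ → ℂ := fun r => Complex.exp ((b * r : ℝ) * Complex.I) / (b * Complex.I) with hg
  have hgn : ∀ r, ‖g r‖ = |b|⁻¹ := fun r => by
    simp only [hg, norm_div, Complex.norm_exp_ofReal_mul_I, norm_mul, Complex.norm_I,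
      Complex.norm_real, Real.norm_eq_abs, mul_one, one_div]
  have hrem : ‖∫ r in l..m, (f' r : ℂ) * g r‖ ≤ (f l - f m) * |b|⁻¹ := by
    have hftc : ∫ r in l..m, -f' r * |b|⁻¹ = (f l - f m) * |b|⁻¹ := by
      rw [intervalIntegral.integral_mul_const, intervalIntegral.integral_neg,
        intervalIntegral.integral_eq_sub_of_hasDerivAt (fun r hr => hf r (hu ▸ hr)) hint, neg_sub]
    rw [← hftc]
    refine intervalIntegral.norm_integral_le_of_norm_le hlm (Eventually.of_forall fun r hr => ?_)
      (hint.neg.mul_const _)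
    rw [norm_mul, hgn, Complex.norm_real, Real.norm_eq_abs,
      abs_of_nonpos (hf' r (Ioc_subset_Icc_self hr))]
  rw [intervalIntegral.integral_mul_deriv_eq_deriv_mul (u := fun r => (f r : ℂ))
    (fun r hr => (hf r (hu ▸ hr)).ofReal_comp) (fun r _ => hasDerivAt_exp_mul_I hb r)
    ⟨hint.1.ofReal, hint.2.ofReal⟩ (Continuous.intervalIntegrable (by fun_prop) _ _)]
  refine (norm_sub_le _ _).trans ((add_le_add (norm_sub_le _ _) hrem).trans_eq ?_)
  rw [norm_mul, norm_mul, hgn, hgn, Complex.norm_real, Complex.norm_real, Real.norm_eq_abs,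
    Real.norm_eq_abs, abs_of_nonneg hm, abs_of_nonneg (hm.trans hlm')]
  ring

section Averaging

variable {f f' : ℝ → ℝ} {r₀ ℓ : ℝ}

lemma antitoneOn_Ici_of_hasDerivAt_nonpos (hf : ∀ r ≥ r₀, HasDerivAt f (f' r) r)
    (hf' : ∀ r ≥ r₀, f' r ≤ 0) : AntitoneOn f (Ici r₀) :=
  antitoneOn_of_hasDerivWithinAt_nonpos (convex_Ici r₀)
    (fun r hr => (hf r hr).continuousAt.continuousWithinAt)
    (fun r hr => (hf r (interior_subset hr)).hasDerivWithinAt)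
    fun r hr => hf' r (interior_subset hr)

lemma tendstoUniformlyOn_integral_mul_exp {b : ℝ} (hℓ : 0 ≤ ℓ) (hb : b ≠ 0)
    (hf : ∀ r ≥ r₀, HasDerivAt f (f' r) r) (hf' : ∀ r ≥ r₀, f' r ≤ 0) (hf0 : ∀ r ≥ r₀, 0 ≤ f r) :
    TendstoUniformlyOn
      (fun k l => ∫ r in l..l + ℓ, (f r : ℂ) * Complex.exp ((b * (k * r) : ℝ) * Complex.I))
      0 atTop (Ici r₀) := by
  rw [Metric.tendstoUniformlyOn_iff]
  intro ε hε
  have hlim : Tendsto (fun k => 2 * f r₀ / |b| * k⁻¹) atTop (𝓝 0) := by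
    simpa using tendsto_inv_atTop_zero.const_mul (2 * f r₀ / |b|)
  filter_upwards [eventually_gt_atTop 0, hlim.eventually_lt_const hε] with k hk hkε l hl
  rw [Pi.zero_apply, dist_zero_left]
  refine lt_of_le_of_lt ?_ hkε
  have hint := norm_integral_mul_exp_le (le_add_of_nonneg_right hℓ) (mul_ne_zero hb hk.ne')
    (fun r hr => hf r (hl.trans hr.1)) (fun r hr => hf' r (hl.trans hr.1))
    (hf0 _ (le_add_of_le_of_nonneg hl hℓ))
  simp only [mul_assoc b k] at hint
  have hfl : f l ≤ f r₀ := antitoneOn_Ici_of_hasDerivAt_nonpos hf hf' self_mem_Ici hl hl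
  calc _ ≤ 2 * f l / |b * k| := hint
    _ = 2 * f l / |b| * k⁻¹ := by
      rw [abs_mul, abs_of_pos hk, div_mul_eq_div_div, div_eq_mul_inv _ k]
    _ ≤ 2 * f r₀ / |b| * k⁻¹ := by gcongr

lemma tendstoUniformlyOn_integral_mul_comp_zero {M : ℝ} {R : ℝ → ℂ} (hr₀ : 0 < r₀) (hℓ : 0 ≤ ℓ)
    (hf : ∀ r ≥ r₀, |f r| ≤ M) (hR : Tendsto R atTop (𝓝 0)) :
    TendstoUniformlyOn (fun k l => ∫ r in l..l + ℓ, (f r : ℂ) * R (k * r)) 0 atTop (Ici r₀) := by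
  rw [Metric.tendstoUniformlyOn_iff]
  intro ε hε
  have hM : 0 ≤ M := (abs_nonneg _).trans (hf r₀ le_rfl)
  set η := ε / (M * ℓ + 1)
  have hη : 0 < η := by positivity
  filter_upwards [(tendsto_id.atTop_mul_const hr₀).eventually (eventually_forall_ge_atTop.2
    (hR.eventually (Metric.closedBall_mem_nhds 0 hη))), eventually_ge_atTop 0] with k hk hk0 l hl
  rw [Pi.zero_apply, dist_zero_left]
  have hint : ‖∫ r in l..l + ℓ, (f r : ℂ) * R (k * r)‖ ≤ M * η * |l + ℓ - l| := by
    refine intervalIntegral.norm_integral_le_of_norm_le_const fun r hr => ?_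
    rw [uIoc_of_le (le_add_of_nonneg_right hℓ)] at hr
    have hr' : r₀ ≤ r := hl.trans hr.1.le
    have hRr : ‖R (k * r)‖ ≤ η := by simpa using hk (k * r) (mul_le_mul_of_nonneg_left hr' hk0)
    rw [norm_mul, Complex.norm_real, Real.norm_eq_abs]
    exact mul_le_mul (hf r hr') hRr (norm_nonneg _) hM
  rw [add_sub_cancel_left, abs_of_nonneg hℓ] at hint
  refine hint.trans_lt ?_
  calc M * η * ℓ = M * ℓ * ε / (M * ℓ + 1) := by ring
    _ < ε := by rw [div_lt_iff₀ (by positivity)]; linarith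

/-- The term `D' e^{ibt}` averages out because `f` is monotone. -/
theorem tendstoUniformlyOn_integral_mul_comp {G : ℝ → ℂ} {D D' : ℂ} {b : ℝ} (hr₀ : 0 < r₀)
    (hℓ : 0 ≤ ℓ) (hf : ∀ r ≥ r₀, HasDerivAt f (f' r) r) (hf' : ∀ r ≥ r₀, f' r ≤ 0)
    (hf0 : ∀ r ≥ r₀, 0 ≤ f r) (hG : ContinuousOn G (Ioi 0)) (hb : b ≠ 0)
    (hlim : Tendsto (fun t : ℝ => G t - D - D' * Complex.exp ((b * t : ℝ) * Complex.I))
      atTop (𝓝 0)) :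
    TendstoUniformlyOn (fun k l => ∫ r in l..l + ℓ, (f r : ℂ) * G (k * r))
      (fun l => D * (∫ r in l..l + ℓ, f r : ℝ)) atTop (Ici r₀) := by
  have hbound : ∀ r ≥ r₀, |f r| ≤ f r₀ := fun r hr => by
    rw [abs_of_nonneg (hf0 r hr)]
    exact antitoneOn_Ici_of_hasDerivAt_nonpos hf hf' self_mem_Ici hr hr
  have hosc := ((lipschitzWith_smul D').uniformContinuous.comp_tendstoUniformlyOn
    (tendstoUniformlyOn_integral_mul_exp hℓ hb hf hf' hf0)).add
      (tendstoUniformlyOn_integral_mul_comp_zero hr₀ hℓ hbound hlim)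
  rw [Metric.tendstoUniformlyOn_iff] at hosc ⊢
  intro ε hε
  filter_upwards [hosc ε hε, eventually_gt_atTop 0] with k hkε hk l hl
  refine lt_of_eq_of_lt ?_ (hkε l hl)
  have hmem : ∀ r ∈ uIcc l (l + ℓ), r₀ ≤ r := fun r hr =>
    hl.out.trans (uIcc_of_le (le_add_of_nonneg_right hℓ) ▸ hr).1
  have hfc : ContinuousOn (fun r => (f r : ℂ)) (uIcc l (l + ℓ)) := fun r hr =>
    (hf r (hmem r hr)).ofReal_comp.continuousAt.continuousWithinAt
  have hGc : ContinuousOn (fun r => G (k * r)) (uIcc l (l + ℓ)) :=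
    hG.comp (by fun_prop) fun r hr => mul_pos hk (hr₀.trans_le (hmem r hr))
  have hE : IntervalIntegrable
      (fun r => (f r : ℂ) * Complex.exp ((b * (k * r) : ℝ) * Complex.I)) volume l (l + ℓ) :=
    (hfc.mul (by fun_prop)).intervalIntegrable
  have hR : IntervalIntegrable (fun r => (f r : ℂ) *
      (G (k * r) - D - D' * Complex.exp ((b * (k * r) : ℝ) * Complex.I))) volume l (l + ℓ) :=
    (hfc.mul ((hGc.sub continuousOn_const).sub (by fun_prop))).intervalIntegrable
  have hsplit : ∫ r in l..l + ℓ, (f r : ℂ) * G (k * r) = D * (∫ r in l..l + ℓ, f r : ℝ)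
      + (D' * (∫ r in l..l + ℓ, (f r : ℂ) * Complex.exp ((b * (k * r) : ℝ) * Complex.I))
        + ∫ r in l..l + ℓ, (f r : ℂ) *
          (G (k * r) - D - D' * Complex.exp ((b * (k * r) : ℝ) * Complex.I))) := by
    rw [← intervalIntegral.integral_ofReal, ← intervalIntegral.integral_const_mul,
      ← intervalIntegral.integral_const_mul, ← intervalIntegral.integral_add (hE.const_mul D') hR,
      ← intervalIntegral.integral_add (hfc.intervalIntegrable.const_mul D)
        ((hE.const_mul D').add hR)]
    refine intervalIntegral.integral_congr fun r _ => ?_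
    ring
  rw [hsplit, dist_self_add_right]
  simp only [Pi.add_apply, Pi.zero_apply, smul_eq_mul, mul_zero, add_zero, Function.comp_apply,
    dist_zero_left]

end Averaging

lemma continuousOn_hankelH0 : ContinuousOn hankelH0 (Ioi 0) := fun _ ht =>
  (hasDerivAt_hankelH0 (ne_of_gt ht)).continuousAt.continuousWithinAt

lemma exists_tendstoUniformlyOn_sqrt_mul_integral_hankelH0 {r₀ ℓ : ℝ} (hr₀ : 0 < r₀)
    (hℓ : 0 ≤ ℓ) : ∃ (s : ℝ) (D : ℂ), s ^ 2 = 1 ∧ D ≠ 0 ∧ TendstoUniformlyOn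
      (fun k l => (√k : ℂ) * ∫ r in l..l + ℓ,
        hankelH0 (k * r) * Complex.exp ((-(s * k * r) : ℝ) * Complex.I))
      (fun l => D * (∫ r in l..l + ℓ, (√r)⁻¹ : ℝ)) atTop (Ici r₀) := by
  obtain ⟨s, D, D', hs, hD, hlim⟩ := exists_hankelH0_modulated_asymptotics
  refine ⟨s, D, hs, hD, ?_⟩
  have hpos : ∀ r ≥ r₀, 0 < r := fun r hr => hr₀.trans_le hr
  have hb : -(2 * s) ≠ 0 := neg_ne_zero.2 (mul_ne_zero two_ne_zero fun h => by simp [h] at hs)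
  have hcont : ContinuousOn (fun t : ℝ => (√t : ℂ) * hankelH0 t
      * Complex.exp ((-(s * t) : ℝ) * Complex.I)) (Ioi 0) := by
    have := continuousOn_hankelH0
    fun_prop
  refine (tendstoUniformlyOn_integral_mul_comp hr₀ hℓ
    (fun r hr => (Real.hasDerivAt_sqrt (hpos r hr).ne').fun_inv (Real.sqrt_pos.2 (hpos r hr)).ne')
    (fun r _ => div_nonpos_of_nonpos_of_nonneg (neg_nonpos.2 (by positivity)) (by positivity))
    (fun r _ => inv_nonneg.2 (Real.sqrt_nonneg r)) hcont hb (by simpa using hlim)).congr ?_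
  filter_upwards [eventually_gt_atTop 0] with k hk l hl
  beta_reduce
  rw [← intervalIntegral.integral_const_mul]
  refine intervalIntegral.integral_congr fun r hr => ?_
  have hr0 : (√r : ℂ) ≠ 0 := by
    rw [uIcc_of_le (le_add_of_nonneg_right hℓ)] at hr
    exact_mod_cast (Real.sqrt_pos.2 (hpos r (hl.out.trans hr.1))).ne'
  simp only [Real.sqrt_mul hk.le]
  rw [mul_assoc s k r]
  push_cast
  field_simp

lemma integral_inv_sqrt_bounds {l ℓ : ℝ} (hl : 0 < l) (hℓ : 0 ≤ ℓ) :
    ℓ * (√(l + ℓ))⁻¹ ≤ ∫ r in l..l + ℓ, (√r)⁻¹ ∧ ∫ r in l..l + ℓ, (√r)⁻¹ ≤ ℓ * (√l)⁻¹ := by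
  have hle : l ≤ l + ℓ := le_add_of_nonneg_right hℓ
  have hpos : ∀ r ∈ Icc l (l + ℓ), 0 < √r := fun r hr => Real.sqrt_pos.2 (hl.trans_le hr.1)
  have hint : IntervalIntegrable (fun r => (√r)⁻¹) volume l (l + ℓ) := by
    refine ContinuousOn.intervalIntegrable ?_
    rw [uIcc_of_le hle]
    exact ContinuousOn.inv₀ (by fun_prop) fun r hr => (hpos r hr).ne'
  constructor
  · simpa using intervalIntegral.integral_mono_on hle (intervalIntegrable_const (c := (√(l + ℓ))⁻¹))
      hint fun r hr => inv_anti₀ (hpos r hr) (Real.sqrt_le_sqrt hr.2)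
  · simpa using intervalIntegral.integral_mono_on hle hint (intervalIntegrable_const (c := (√l)⁻¹))
      fun r hr => inv_anti₀ (Real.sqrt_pos.2 hl) (Real.sqrt_le_sqrt hr.1)

lemma norm_mul_sub_le_re_conj_div_norm_mul {D z : ℂ} {P δ : ℝ} (hD : D ≠ 0)
    (h : ‖z - D * P‖ ≤ δ) : ‖D‖ * P - δ ≤ (starRingEnd ℂ D / ‖D‖ * z).re := by
  have hD' : (‖D‖ : ℂ) ≠ 0 := by exact_mod_cast norm_ne_zero_iff.2 hD
  have hsplit : starRingEnd ℂ D / ‖D‖ * z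
      = (‖D‖ * P : ℝ) + starRingEnd ℂ D / ‖D‖ * (z - D * P) := by
    push_cast
    field_simp
    linear_combination (P : ℂ) * Complex.conj_mul' D
  have hre := (abs_le.1 (Complex.abs_re_le_norm (starRingEnd ℂ D / ‖D‖ * (z - D * P)))).1
  rw [norm_mul, norm_div, RCLike.norm_conj, Complex.norm_real, norm_norm,
    div_self (norm_ne_zero_iff.2 hD), one_mul] at hre
  rw [hsplit, Complex.add_re, Complex.ofReal_re]
  linarith

theorem exists_hankelH0_integral_bounds {r₀ r₁ ℓ : ℝ} (hr₀ : 0 < r₀) (hr₁ : r₀ ≤ r₁) (hℓ : 0 < ℓ) :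
    ∃ (s : ℝ) (ζ : ℂ) (c C : ℝ), s ^ 2 = 1 ∧ ‖ζ‖ = 1 ∧ 0 < c ∧
      ∀ᶠ k in atTop, ∀ l ∈ Icc r₀ r₁,
        c / √k ≤ (ζ * ∫ r in l..l + ℓ,
          hankelH0 (k * r) * Complex.exp ((-(s * k * r) : ℝ) * Complex.I)).re ∧
        ‖∫ r in l..l + ℓ, hankelH0 (k * r) * Complex.exp ((-(s * k * r) : ℝ) * Complex.I)‖
          ≤ C / √k := by
  obtain ⟨s, D, hs, hD, hlim⟩ :=
    exists_tendstoUniformlyOn_sqrt_mul_integral_hankelH0 hr₀ hℓ.le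
  rw [Metric.tendstoUniformlyOn_iff] at hlim
  have hDpos : 0 < ‖D‖ := norm_pos_iff.2 hD
  set m := ℓ * (√(r₁ + ℓ))⁻¹
  have hm : 0 < m := mul_pos hℓ (inv_pos.2 (Real.sqrt_pos.2 (by linarith)))
  refine ⟨s, starRingEnd ℂ D / ‖D‖, ‖D‖ * m / 2, ‖D‖ * (ℓ * (√r₀)⁻¹) + ‖D‖ * m / 2, hs, ?_,
    by positivity, ?_⟩
  · rw [norm_div, RCLike.norm_conj, Complex.norm_real, norm_norm, div_self hDpos.ne']
  filter_upwards [eventually_gt_atTop 0, hlim (‖D‖ * m / 2) (by positivity)] with k hk h l hl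
  have hk' : 0 < √k := Real.sqrt_pos.2 hk
  have hl0 : 0 < l := hr₀.trans_le hl.1
  obtain ⟨hPl, hPu⟩ := integral_inv_sqrt_bounds hl0 hℓ.le
  set P := ∫ r in l..l + ℓ, (√r)⁻¹
  set J := ∫ r in l..l + ℓ, hankelH0 (k * r) * Complex.exp ((-(s * k * r) : ℝ) * Complex.I)
  have hJ : ‖(√k : ℂ) * J - D * P‖ ≤ ‖D‖ * m / 2 := by
    rw [← dist_eq_norm, dist_comm]
    exact (h l hl.1).le
  have hmP : m ≤ P := by
    refine hPl.trans' (mul_le_mul_of_nonneg_left (inv_anti₀ ?_ (Real.sqrt_le_sqrt ?_)) hℓ.le)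
    · exact Real.sqrt_pos.2 (by linarith)
    · linarith [hl.2]
  have hPr₀ : P ≤ ℓ * (√r₀)⁻¹ := hPu.trans (mul_le_mul_of_nonneg_left
    (inv_anti₀ (Real.sqrt_pos.2 hr₀) (Real.sqrt_le_sqrt hl.1)) hℓ.le)
  constructor
  · have hre := norm_mul_sub_le_re_conj_div_norm_mul hD hJ
    rw [mul_left_comm _ (√k : ℂ) J, Complex.re_ofReal_mul] at hre
    rw [div_le_iff₀' hk']
    nlinarith
  · rw [le_div_iff₀' hk', ← abs_of_pos hk', ← Real.norm_eq_abs, ← Complex.norm_real, ← norm_mul]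
    calc ‖(√k : ℂ) * J‖ ≤ ‖D * P‖ + ‖(√k : ℂ) * J - D * P‖ := norm_le_norm_add_norm_sub' _ _
      _ ≤ ‖D‖ * (ℓ * (√r₀)⁻¹) + ‖D‖ * m / 2 := by
        rw [norm_mul, Complex.norm_real, Real.norm_eq_abs, abs_of_pos (hm.trans_le hmP)]
        gcongr

/-! ### Surface gradients and tangential derivatives -/

section SurfaceGradient

variable {d : ℕ} {Ω : Set (Space d)}

/-- The inclusion of `ℝᵈ` into `ℂᵈ`, used to pair real tangent vectors with surface gradients. -/
def complexify (τ : Space d) : EuclideanSpace ℂ (Fin d) :=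
  WithLp.toLp 2 fun j => (τ j : ℂ)

lemma norm_complexify (τ : Space d) : ‖complexify τ‖ = ‖τ‖ := by
  simp [complexify, EuclideanSpace.norm_eq]

lemma continuous_complexify : Continuous (complexify : Space d → EuclideanSpace ℂ (Fin d)) := by
  unfold complexify
  fun_prop

lemma inner_complexify_surfaceGradient (u : Space d → ℂ) {x τ : Space d}
    (hτ : τ ∈ tangentSpan Ω x) :
    inner ℂ (complexify τ) (surfaceGradient Ω u x) = fderiv ℝ u x τ := by
  have hsum : τ = ∑ j, τ j • EuclideanSpace.single j (1 : ℝ) := by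
    simpa using ((EuclideanSpace.basisFun (Fin d) ℝ).sum_repr τ).symm
  conv_rhs => rw [← Submodule.starProjection_eq_self_iff.2 hτ, hsum]
  simp only [map_sum, map_smul, PiLp.inner_apply, surfaceGradient, complexify, Complex.real_smul]
  refine Finset.sum_congr rfl fun j _ => ?_
  simp [mul_comm]

lemma mem_tangentSpan_of_hasDerivAt {c : ℝ → Space d} {c' : Space d} {t : ℝ}
    (hc : HasDerivAt c c' t) (hmem : ∀ᶠ s in 𝓝 t, c s ∈ frontier Ω) :
    c' ∈ tangentSpan Ω (c t) := by
  have h1 : (1 : ℝ) ∈ tangentConeAt ℝ (c ⁻¹' frontier Ω) t := by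
    rw [tangentConeAt_of_mem_nhds (show c ⁻¹' frontier Ω ∈ 𝓝 t from hmem)]
    trivial
  have hcone := (hc.hasFDerivAt.hasFDerivWithinAt (s := c ⁻¹' frontier Ω)).mapsTo_tangent_cone h1
  refine Submodule.subset_span ?_
  simpa using tangentConeAt_mono (𝕜 := ℝ) (x := c t) (image_preimage_subset c _) hcone

end SurfaceGradient

section PlaneWave

variable {d : ℕ} (e : Space d) (κ : ℝ)

/-- The plane wave `x ↦ e^{iκ e·x}`. -/
def planeWave (x : Space d) : ℂ :=
  Complex.exp ((κ * ⟪e, x⟫ : ℝ) * Complex.I)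

lemma norm_planeWave (x : Space d) : ‖planeWave e κ x‖ = 1 :=
  Complex.norm_exp_ofReal_mul_I _

lemma continuous_planeWave : Continuous (planeWave e κ) := by
  unfold planeWave
  fun_prop

lemma planeWave_neg_sub (x y : Space d) :
    planeWave e (-κ) (x - y) = planeWave e (-κ) x * planeWave e κ y := by
  simp only [planeWave]
  rw [← Complex.exp_add, inner_sub_right]
  push_cast
  ring_nf

variable {e} in
lemma hasDerivAt_planeWave_comp {c : ℝ → Space d} {c' : Space d} {t : ℝ} (hc : HasDerivAt c c' t) :
    HasDerivAt (fun t => planeWave e κ (c t))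
      (planeWave e κ (c t) * ((κ * ⟪e, c'⟫ : ℝ) * Complex.I)) t := by
  have hinner : HasDerivAt (fun t => ⟪e, c t⟫) ⟪e, c'⟫ t := by
    simpa using (hasDerivAt_const t e).inner ℝ hc
  exact ((hinner.const_mul κ).ofReal_comp.mul_const Complex.I).cexp

end PlaneWave

section Cutoff

variable {α β t : ℝ}

/-- A function on `[α, β]` that is positive inside and vanishes at the end points, by which plane
waves are multiplied to avoid boundary terms in an integration by parts. -/
def cutoff (α β t : ℝ) : ℝ := (t - α) * (β - t)

lemma cutoff_nonneg (ht : t ∈ Icc α β) : 0 ≤ cutoff α β t :=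
  mul_nonneg (sub_nonneg.2 ht.1) (sub_nonneg.2 ht.2)

lemma cutoff_le (ht : t ∈ Icc α β) : cutoff α β t ≤ (β - α) ^ 2 := by
  rw [cutoff, sq]
  exact mul_le_mul (by linarith [ht.2]) (by linarith [ht.1]) (sub_nonneg.2 ht.2)
    (by linarith [ht.1, ht.2])

lemma hasDerivAt_cutoff (α β t : ℝ) : HasDerivAt (cutoff α β) (α + β - 2 * t) t := by
  refine (((hasDerivAt_id t).sub_const α).mul ((hasDerivAt_id t).const_sub β)).congr_deriv ?_
  simp only [id]
  ring

lemma abs_deriv_cutoff_le (ht : t ∈ Icc α β) : |α + β - 2 * t| ≤ β - α :=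
  abs_le.2 ⟨by linarith [ht.2], by linarith [ht.1]⟩

lemma continuous_cutoff (α β : ℝ) : Continuous (cutoff α β) := by
  unfold cutoff
  fun_prop

lemma setIntegral_cutoff (h : α ≤ β) : ∫ t in Icc α β, cutoff α β t = (β - α) ^ 3 / 6 := by
  rw [integral_Icc_eq_integral_Ioc, ← intervalIntegral.integral_of_le h]
  have hd : ∀ t ∈ uIcc α β, HasDerivAt
      (fun t => (t - α) ^ 2 / 2 * (β - α) - (t - α) ^ 3 / 3) (cutoff α β t) t := fun t _ => by
    have hid := (hasDerivAt_id t).sub_const α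
    refine ((((hid.pow 2).div_const 2).mul_const _).sub ((hid.pow 3).div_const 3)).congr_deriv ?_
    simp only [id, cutoff]
    push_cast
    ring
  rw [intervalIntegral.integral_eq_sub_of_hasDerivAt hd
    ((continuous_cutoff α β).intervalIntegrable _ _)]
  ring

end Cutoff

/-- A piece `carrier` of `∂Ω` that carries a one-parameter family of curves `t ↦ map (t, w)`,
`α ≤ t ≤ β`, tangent to the vector field `field` and progressing in the direction `e`. The
parameter `w` is distributed according to `ν`, and the image of `dt ⊗ ν` is controlled by surface
measure. -/
structure BoundaryStrip {d : ℕ} (Ω : Set (Space d)) (e : Space d) where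
  α : ℝ
  β : ℝ
  ν : Measure ℝ
  K : ℝ≥0
  carrier : Set (Space d)
  map : ℝ × ℝ → Space d
  field : Space d → Space d
  lt : α < β
  isFiniteMeasure : IsFiniteMeasure ν
  K_pos : 0 < K
  measurableSet_carrier : MeasurableSet carrier
  measurable_map : Measurable map
  measurable_field : Measurable field
  map_prod_le :
    Measure.map map ((volume.restrict (Icc α β)).prod ν) ≤ K • surfaceMeasure Ω
  ae_mem : ∀ᵐ w ∂ν, ∀ t ∈ Icc α β, map (t, w) ∈ carrier
  ae_hasDerivAt : ∀ᵐ w ∂ν, ∀ t ∈ Icc α β, HasDerivAt (fun t => map (t, w)) (field (map (t, w))) t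
  field_mem_tangentSpan : ∀ x ∈ carrier, field x ∈ tangentSpan Ω x
  norm_field_le : ∀ x ∈ carrier, ‖field x‖ ≤ 2
  le_inner_field : ∀ x ∈ carrier, 1 / 2 ≤ ⟪e, field x⟫

namespace BoundaryStrip

variable {d : ℕ} {Ω : Set (Space d)} {e : Space d} (B : BoundaryStrip Ω e)

instance : IsFiniteMeasure B.ν := B.isFiniteMeasure

/-- The measure `dt ⊗ ν` on the parameters of a boundary strip. -/
abbrev paramMeasure : Measure (ℝ × ℝ) := (volume.restrict (Icc B.α B.β)).prod B.ν

/-- The total mass of the parameter measure. -/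
def mass : ℝ := (B.β - B.α) * B.ν.real univ

lemma length_pos : 0 < B.β - B.α := sub_pos.2 B.lt

lemma mass_nonneg : 0 ≤ B.mass := mul_nonneg B.length_pos.le measureReal_nonneg

lemma paramMeasure_real_univ : B.paramMeasure.real univ = B.mass := by
  rw [← univ_prod_univ, measureReal_prod_prod, measureReal_restrict_apply_univ,
    Real.volume_real_Icc_of_le B.lt.le, mass]

lemma paramMeasure_univ : B.paramMeasure univ = ENNReal.ofReal B.mass := by
  rw [← paramMeasure_real_univ, ofReal_measureReal]

lemma ae_mem_param : ∀ᵐ p ∂B.paramMeasure, p.1 ∈ Icc B.α B.β ∧ B.map p ∈ B.carrier := by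
  filter_upwards [Measure.quasiMeasurePreserving_fst.ae (ae_restrict_mem measurableSet_Icc),
    Measure.quasiMeasurePreserving_snd.ae B.ae_mem] with p hp hmem
  exact ⟨hp, hmem p.1 hp⟩

lemma mass_le_surfaceMeasure : ENNReal.ofReal (B.mass / B.K) ≤ surfaceMeasure Ω B.carrier := by
  have hpre : B.paramMeasure (B.map ⁻¹' B.carrier) = ENNReal.ofReal B.mass := by
    rw [← paramMeasure_univ]
    exact measure_congr (eventuallyEq_univ.2 (B.ae_mem_param.mono fun p hp => hp.2))
  have hle := B.map_prod_le B.carrier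
  rw [Measure.map_apply B.measurable_map B.measurableSet_carrier, hpre] at hle
  rw [ENNReal.ofReal_div_of_pos (by exact_mod_cast B.K_pos), ENNReal.ofReal_coe_nnreal]
  exact ENNReal.div_le_of_le_mul' hle

lemma le_normL2 {v : Space d → ℂ} {a : ℝ} (ha : 0 ≤ a) (hv : ∀ x ∈ B.carrier, a ≤ ‖v x‖) :
    ENNReal.ofReal (a * √(B.mass / B.K)) ≤ normL2 Ω v := by
  calc ENNReal.ofReal (a * √(B.mass / B.K))
      = ‖a‖ₑ * ENNReal.ofReal (B.mass / B.K) ^ (1 / 2 : ℝ) := by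
        rw [ENNReal.ofReal_mul ha, Real.enorm_eq_ofReal ha, Real.sqrt_eq_rpow,
          ← ENNReal.ofReal_rpow_of_nonneg (div_nonneg B.mass_nonneg B.K.coe_nonneg) (by norm_num)]
    _ ≤ ‖a‖ₑ * surfaceMeasure Ω B.carrier ^ (1 / 2 : ℝ) := by
        gcongr
        exact B.mass_le_surfaceMeasure
    _ = eLpNorm (B.carrier.indicator fun _ => a) 2 (surfaceMeasure Ω) := by
        simp [eLpNorm_indicator_const B.measurableSet_carrier]
    _ ≤ normL2 Ω v := eLpNorm_mono fun x => by
        by_cases hx : x ∈ B.carrier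
        · rw [indicator_of_mem hx, Real.norm_of_nonneg ha]
          exact hv x hx
        · rw [indicator_of_notMem hx, norm_zero]
          exact norm_nonneg _

lemma aestronglyMeasurable_comp {E : Type*} [TopologicalSpace E] {f : Space d → E}
    (hf : AEStronglyMeasurable f (surfaceMeasure Ω)) :
    AEStronglyMeasurable (fun p => f (B.map p)) B.paramMeasure :=
  ((hf.smul_measure B.K).mono_measure B.map_prod_le).comp_measurable B.measurable_map

section Pairing

variable {f : Space d → ℂ} {w : ℝ × ℝ → ℂ} {M : ℝ}

lemma lintegral_comp_mul_le (hf : AEStronglyMeasurable f (surfaceMeasure Ω))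
    (hM : ∀ᵐ p ∂B.paramMeasure, ‖w p‖ ≤ M) :
    ∫⁻ p, ‖f (B.map p) * w p‖ₑ ∂B.paramMeasure ≤
      ENNReal.ofReal M * (ENNReal.ofReal √(B.K * B.mass) * eLpNorm f 2 (surfaceMeasure Ω)) := by
  have hsup : eLpNorm (fun p => f (B.map p)) 2 B.paramMeasure
      ≤ (B.K : ℝ≥0∞) ^ (1 / 2 : ℝ) * eLpNorm f 2 (surfaceMeasure Ω) := by
    calc eLpNorm (fun p => f (B.map p)) 2 B.paramMeasure
        = eLpNorm f 2 (Measure.map B.map B.paramMeasure) := (eLpNorm_map_measure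
          ((hf.smul_measure B.K).mono_measure B.map_prod_le) B.measurable_map.aemeasurable).symm
      _ ≤ eLpNorm f 2 ((B.K : ℝ≥0∞) • surfaceMeasure Ω) := eLpNorm_mono_measure f B.map_prod_le
      _ = _ := by rw [eLpNorm_smul_measure_of_ne_top (by norm_num)]; simp
  have hcs := eLpNorm_le_eLpNorm_mul_rpow_measure_univ (p := 1) (q := 2) (by norm_num)
    (B.aestronglyMeasurable_comp hf)
  rw [eLpNorm_one_eq_lintegral_enorm] at hcs
  calc ∫⁻ p, ‖f (B.map p) * w p‖ₑ ∂B.paramMeasure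
      ≤ ∫⁻ p, ENNReal.ofReal M * ‖f (B.map p)‖ₑ ∂B.paramMeasure :=
        lintegral_mono_ae (hM.mono fun p hp => by
          rw [enorm_mul, mul_comm, ← ofReal_norm (w p)]
          gcongr)
    _ ≤ _ := by
        rw [lintegral_const_mul' _ _ ENNReal.ofReal_ne_top]
        gcongr
        refine hcs.trans ((mul_le_mul_left hsup _).trans_eq ?_)
        rw [B.paramMeasure_univ, Real.sqrt_mul B.K.coe_nonneg,
          ENNReal.ofReal_mul (Real.sqrt_nonneg _), Real.sqrt_eq_rpow, Real.sqrt_eq_rpow,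
          ← ENNReal.ofReal_rpow_of_nonneg B.K.coe_nonneg (by norm_num),
          ← ENNReal.ofReal_rpow_of_nonneg B.mass_nonneg (by norm_num), ENNReal.ofReal_coe_nnreal]
        norm_num
        ring

lemma integrable_comp_mul (hf : MemLp f 2 (surfaceMeasure Ω))
    (hw : AEStronglyMeasurable w B.paramMeasure) (hM : ∀ᵐ p ∂B.paramMeasure, ‖w p‖ ≤ M) :
    Integrable (fun p => f (B.map p) * w p) B.paramMeasure :=
  ⟨(B.aestronglyMeasurable_comp hf.1).mul hw, (B.lintegral_comp_mul_le hf.1 hM).trans_lt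
    (ENNReal.mul_lt_top ENNReal.ofReal_lt_top (ENNReal.mul_lt_top ENNReal.ofReal_lt_top hf.2))⟩

lemma tendsto_integral_comp_mul {F : ℕ → Space d → ℂ}
    (hF : ∀ n, AEStronglyMeasurable (F n) (surfaceMeasure Ω)) (hf : MemLp f 2 (surfaceMeasure Ω))
    (hlim : Tendsto (fun n => eLpNorm (F n - f) 2 (surfaceMeasure Ω)) atTop (𝓝 0))
    (hw : AEStronglyMeasurable w B.paramMeasure) (hM : ∀ᵐ p ∂B.paramMeasure, ‖w p‖ ≤ M) :
    Tendsto (fun n => ∫ p, F n (B.map p) * w p ∂B.paramMeasure) atTop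
      (𝓝 (∫ p, f (B.map p) * w p ∂B.paramMeasure)) := by
  refine tendsto_integral_of_L1 _ (B.integrable_comp_mul hf hw hM).aestronglyMeasurable ?_ ?_
  · filter_upwards [hlim.eventually_lt_const ENNReal.zero_lt_top] with n hn
    have hFn : MemLp (F n) 2 (surfaceMeasure Ω) := by
      simpa using MemLp.add (f := F n - f) ⟨(hF n).sub hf.1, hn⟩ hf
    exact B.integrable_comp_mul hFn hw hM
  · simp only [← sub_mul]
    refine tendsto_of_tendsto_of_tendsto_of_le_of_le tendsto_const_nhds ?_ (fun _ => zero_le)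
      fun n => B.lintegral_comp_mul_le ((hF n).sub hf.1) hM
    have h0 := ENNReal.Tendsto.const_mul (a := ENNReal.ofReal M) (ENNReal.Tendsto.const_mul
      (a := ENNReal.ofReal √(B.K * B.mass)) hlim (Or.inr ENNReal.ofReal_ne_top))
      (Or.inr ENNReal.ofReal_ne_top)
    simpa only [mul_zero] using h0

end Pairing

end BoundaryStrip

namespace BoundaryStrip

variable {d : ℕ} {Ω : Set (Space d)} {e : Space d} (B : BoundaryStrip Ω e)

section FieldComponent

variable {g : Space d → EuclideanSpace ℂ (Fin d)} {u : Space d → ℂ}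

/-- The component of a vector field `g` along the tangent field of a boundary strip, extended by
zero to all of `ℝᵈ`. -/
def fieldComponent (g : Space d → EuclideanSpace ℂ (Fin d)) : Space d → ℂ :=
  B.carrier.indicator fun x => inner ℂ (complexify (B.field x)) (g x)

lemma norm_fieldComponent_le (g : Space d → EuclideanSpace ℂ (Fin d)) (x : Space d) :
    ‖B.fieldComponent g x‖ ≤ 2 * ‖g x‖ := by
  by_cases hx : x ∈ B.carrier
  · rw [fieldComponent, indicator_of_mem hx]
    refine (norm_inner_le_norm _ _).trans ?_
    rw [norm_complexify]
    gcongr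
    exact B.norm_field_le x hx
  · rw [fieldComponent, indicator_of_notMem hx, norm_zero]
    positivity

lemma eLpNorm_fieldComponent_le (g : Space d → EuclideanSpace ℂ (Fin d)) :
    eLpNorm (B.fieldComponent g) 2 (surfaceMeasure Ω) ≤ 2 * eLpNorm g 2 (surfaceMeasure Ω) := by
  simpa using eLpNorm_le_mul_eLpNorm_of_ae_le_mul
    (Eventually.of_forall (B.norm_fieldComponent_le g)) (p := 2) (μ := surfaceMeasure Ω)

lemma fieldComponent_sub (f g : Space d → EuclideanSpace ℂ (Fin d)) :
    B.fieldComponent (fun x => f x - g x) = B.fieldComponent f - B.fieldComponent g := by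
  simp only [fieldComponent, inner_sub_right]
  exact indicator_sub _ _ _

lemma aestronglyMeasurable_fieldComponent (hg : AEStronglyMeasurable g (surfaceMeasure Ω)) :
    AEStronglyMeasurable (B.fieldComponent g) (surfaceMeasure Ω) :=
  (AEStronglyMeasurable.inner (continuous_complexify.measurable.comp
    B.measurable_field).aestronglyMeasurable hg).indicator B.measurableSet_carrier

lemma fieldComponent_surfaceGradient (u : Space d → ℂ) :
    B.fieldComponent (surfaceGradient Ω u)
      = B.carrier.indicator fun x => fderiv ℝ u x (B.field x) :=
  indicator_congr fun x hx => inner_complexify_surfaceGradient u (B.field_mem_tangentSpan x hx)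

/-- Unlike its component along a measurable tangent field, the surface gradient of a smooth
function need not be measurable, as nothing is known about the tangent cones away from the strip. -/
lemma measurable_fieldComponent_surfaceGradient (hu : ContDiff ℝ 1 u) :
    Measurable (B.fieldComponent (surfaceGradient Ω u)) := by
  rw [fieldComponent_surfaceGradient]
  have hcont : Continuous fun q : Space d × Space d => fderiv ℝ u q.1 q.2 :=
    ((hu.continuous_fderiv one_ne_zero).comp continuous_fst).clm_apply continuous_snd
  exact (hcont.measurable.comp (measurable_id.prodMk B.measurable_field)).indicator
    B.measurableSet_carrier

end FieldComponent

section Weights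

variable (κ : ℝ)

/-- The plane wave `e^{-iκ e·x}`, cut off at the ends of the curves of the strip. -/
def weight (p : ℝ × ℝ) : ℂ := planeWave e (-κ) (B.map p) * cutoff B.α B.β p.1

/-- Minus the derivative of `BoundaryStrip.weight` along the curves of the strip. -/
def testWeight (p : ℝ × ℝ) : ℂ :=
  planeWave e (-κ) (B.map p) *
    ((κ * ⟪e, B.field (B.map p)⟫ * cutoff B.α B.β p.1 : ℝ) * Complex.I
      - (B.α + B.β - 2 * p.1 : ℝ))

lemma hasDerivAt_weight {w t : ℝ}
    (h : HasDerivAt (fun t => B.map (t, w)) (B.field (B.map (t, w))) t) :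
    HasDerivAt (fun t => B.weight κ (t, w)) (-B.testWeight κ (t, w)) t := by
  refine ((hasDerivAt_planeWave_comp (-κ) h).mul
    (hasDerivAt_cutoff B.α B.β t).ofReal_comp).congr_deriv ?_
  rw [testWeight]
  push_cast
  ring

lemma measurable_planeWave_map : Measurable fun p => planeWave e (-κ) (B.map p) :=
  (continuous_planeWave e (-κ)).measurable.comp B.measurable_map

lemma measurable_weight : Measurable (B.weight κ) :=
  (B.measurable_planeWave_map κ).mul
    (Complex.measurable_ofReal.comp ((continuous_cutoff _ _).measurable.comp measurable_fst))

lemma measurable_inner_field_mul_cutoff :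
    Measurable fun p => ⟪e, B.field (B.map p)⟫ * cutoff B.α B.β p.1 :=
  ((continuous_const.inner continuous_id).measurable.comp
    (B.measurable_field.comp B.measurable_map)).mul
    ((continuous_cutoff _ _).measurable.comp measurable_fst)

lemma measurable_testWeight : Measurable (B.testWeight κ) := by
  have hfield := B.measurable_inner_field_mul_cutoff
  unfold testWeight
  exact (B.measurable_planeWave_map κ).mul (by simp only [mul_assoc]; fun_prop)

lemma abs_inner_field_le (he : ‖e‖ = 1) {x : Space d} (hx : x ∈ B.carrier) :
    |⟪e, B.field x⟫| ≤ 2 :=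
  (abs_real_inner_le_norm _ _).trans (by rw [he, one_mul]; exact B.norm_field_le x hx)

lemma ae_norm_weight_le : ∀ᵐ p ∂B.paramMeasure, ‖B.weight κ p‖ ≤ (B.β - B.α) ^ 2 := by
  filter_upwards [B.ae_mem_param] with p hp
  rw [weight, norm_mul, norm_planeWave, one_mul, Complex.norm_real,
    Real.norm_of_nonneg (cutoff_nonneg hp.1)]
  exact cutoff_le hp.1

lemma ae_norm_testWeight_le (he : ‖e‖ = 1) : ∀ᵐ p ∂B.paramMeasure,
    ‖B.testWeight κ p‖ ≤ |κ| * 2 * (B.β - B.α) ^ 2 + (B.β - B.α) := by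
  filter_upwards [B.ae_mem_param] with p ⟨hp, hmem⟩
  have hfield := B.abs_inner_field_le he hmem
  rw [testWeight, norm_mul, norm_planeWave, one_mul]
  refine (norm_sub_le _ _).trans (add_le_add ?_ ?_)
  · rw [norm_mul, Complex.norm_I, mul_one, Complex.norm_real, Real.norm_eq_abs, abs_mul, abs_mul,
      abs_of_nonneg (cutoff_nonneg hp)]
    have := cutoff_nonneg hp
    gcongr
    exact cutoff_le hp
  · rw [Complex.norm_real]
    exact abs_deriv_cutoff_le hp

end Weights

variable {κ : ℝ}

lemma integral_mul_testWeight_of_contDiff (he : ‖e‖ = 1) (κ : ℝ) {u : Space d → ℂ}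
    (hu : ContDiff ℝ 1 u) (hcu : HasCompactSupport u) :
    ∫ p, u (B.map p) * B.testWeight κ p ∂B.paramMeasure =
      ∫ p, B.fieldComponent (surfaceGradient Ω u) (B.map p) * B.weight κ p ∂B.paramMeasure := by
  obtain ⟨C₀, hC₀⟩ := hcu.exists_bound_of_continuous hu.continuous
  obtain ⟨C₁, hC₁⟩ := (hcu.fderiv ℝ).exists_bound_of_continuous (hu.continuous_fderiv one_ne_zero)
  have hint₀ : Integrable (fun p => u (B.map p) * B.testWeight κ p) B.paramMeasure :=
    (Integrable.of_bound (B.measurable_testWeight κ).aestronglyMeasurable _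
      (B.ae_norm_testWeight_le κ he)).bdd_mul
      (hu.continuous.measurable.comp B.measurable_map).aestronglyMeasurable
      (Eventually.of_forall fun p => hC₀ (B.map p))
  have hint₁ : Integrable (fun p => B.fieldComponent (surfaceGradient Ω u) (B.map p)
      * B.weight κ p) B.paramMeasure := by
    refine (Integrable.of_bound (B.measurable_weight κ).aestronglyMeasurable _
      (B.ae_norm_weight_le κ)).bdd_mul (c := C₁ * 2) ((B.measurable_fieldComponent_surfaceGradient
      hu).comp B.measurable_map).aestronglyMeasurable ?_
    filter_upwards [B.ae_mem_param] with p hp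
    rw [fieldComponent_surfaceGradient, indicator_of_mem hp.2]
    exact (ContinuousLinearMap.le_opNorm _ _).trans
      (mul_le_mul (hC₁ _) (B.norm_field_le _ hp.2) (norm_nonneg _) ((norm_nonneg _).trans (hC₁ 0)))
  rw [← sub_eq_zero, ← integral_sub hint₀ hint₁]
  refine (integral_prod_symm _ (hint₀.sub hint₁)).trans (integral_eq_zero_of_ae ?_)
  filter_upwards [B.ae_mem, B.ae_hasDerivAt, hint₀.prod_left_ae, hint₁.prod_left_ae]
    with w hmem hderiv hw₀ hw₁
  rw [integral_Icc_eq_integral_Ioc, ← intervalIntegral.integral_of_le B.lt.le,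
    intervalIntegral.integral_eq_sub_of_hasDerivAt
      (f := fun t => -(u (B.map (t, w)) * B.weight κ (t, w))) ?_ ?_]
  · simp [weight, cutoff]
  · intro t ht
    rw [uIcc_of_le B.lt.le] at ht
    have hcomp := (hu.differentiable one_ne_zero _).hasFDerivAt.comp_hasDerivAt t (hderiv t ht)
    refine (hcomp.mul (B.hasDerivAt_weight κ (hderiv t ht))).neg.congr_deriv ?_
    simp only [Pi.sub_apply, fieldComponent_surfaceGradient, indicator_of_mem (hmem t ht),
      Function.comp_apply]
    ring
  · rw [intervalIntegrable_iff_integrableOn_Icc_of_le B.lt.le]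
    exact hw₀.sub hw₁

/-- Integration by parts along the strip; the cutoff removes the boundary terms. -/
lemma integral_mul_testWeight (he : ‖e‖ = 1) (κ : ℝ) {v : Space d → ℂ}
    {g : Space d → EuclideanSpace ℂ (Fin d)} (hv : HasSurfaceGradient Ω v g) :
    ∫ p, v (B.map p) * B.testWeight κ p ∂B.paramMeasure =
      ∫ p, B.fieldComponent g (B.map p) * B.weight κ p ∂B.paramMeasure := by
  obtain ⟨hv2, hg2, u, hu, hlim, hlimg⟩ := hv
  have hu1 : ∀ n, ContDiff ℝ 1 (u n) := fun n => (hu n).1.of_le (by simp)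
  have hg2' : MemLp (B.fieldComponent g) 2 (surfaceMeasure Ω) :=
    ⟨B.aestronglyMeasurable_fieldComponent hg2.1, (B.eLpNorm_fieldComponent_le g).trans_lt
      (ENNReal.mul_lt_top (by simp) hg2.2)⟩
  have hlimg' : Tendsto (fun n => eLpNorm (B.fieldComponent (surfaceGradient Ω (u n))
      - B.fieldComponent g) 2 (surfaceMeasure Ω)) atTop (𝓝 0) := by
    simp only [← fieldComponent_sub]
    refine tendsto_of_tendsto_of_tendsto_of_le_of_le tendsto_const_nhds ?_ (fun _ => zero_le)
      fun n => B.eLpNorm_fieldComponent_le _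
    simpa only [mul_zero] using ENNReal.Tendsto.const_mul hlimg (Or.inr (by simp))
  refine tendsto_nhds_unique (B.tendsto_integral_comp_mul
    (fun n => (hu n).1.continuous.aestronglyMeasurable) hv2 hlim
    (B.measurable_testWeight κ).aestronglyMeasurable (B.ae_norm_testWeight_le κ he)) ?_
  simp only [B.integral_mul_testWeight_of_contDiff he κ (hu1 _) (hu _).2]
  exact B.tendsto_integral_comp_mul
    (fun n => (B.measurable_fieldComponent_surfaceGradient (hu1 n)).aestronglyMeasurable)
    hg2' hlimg' (B.measurable_weight κ).aestronglyMeasurable (B.ae_norm_weight_le κ)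

lemma enorm_integral_mul_testWeight_le (he : ‖e‖ = 1) (κ : ℝ) {v : Space d → ℂ}
    {g : Space d → EuclideanSpace ℂ (Fin d)} (hv : HasSurfaceGradient Ω v g) :
    ‖∫ p, v (B.map p) * B.testWeight κ p ∂B.paramMeasure‖ₑ ≤
      ENNReal.ofReal (2 * (B.β - B.α) ^ 2 * √(B.K * B.mass))
        * eLpNorm g 2 (surfaceMeasure Ω) := by
  rw [B.integral_mul_testWeight he κ hv]
  refine (enorm_integral_le_lintegral_enorm _).trans ((B.lintegral_comp_mul_le
    (B.aestronglyMeasurable_fieldComponent hv.2.1.1) (B.ae_norm_weight_le κ)).trans ?_)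
  refine (mul_le_mul_right (mul_le_mul_right (B.eLpNorm_fieldComponent_le g) _) _).trans_eq ?_
  rw [ENNReal.ofReal_mul (by positivity), ENNReal.ofReal_mul zero_le_two, ENNReal.ofReal_ofNat]
  ring

end BoundaryStrip

lemma integral_le_norm_integral_of_le_re {Y : Type*} [MeasurableSpace Y] {μ : Measure Y}
    {f : Y → ℂ} {g : Y → ℝ} {ζ : ℂ} (hζ : ‖ζ‖ = 1) (hg : Integrable g μ) (hf : Integrable f μ)
    (h : ∀ᵐ y ∂μ, g y ≤ (ζ * f y).re) : ∫ y, g y ∂μ ≤ ‖∫ y, f y ∂μ‖ := by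
  calc ∫ y, g y ∂μ ≤ ∫ y, (ζ * f y).re ∂μ := integral_mono_ae hg (hf.const_mul ζ).re h
    _ = (∫ y, ζ * f y ∂μ).re := integral_re (hf.const_mul ζ)
    _ ≤ ‖∫ y, ζ * f y ∂μ‖ := Complex.re_le_norm _
    _ = ‖∫ y, f y ∂μ‖ := by rw [integral_const_mul, norm_mul, hζ, one_mul]

/-- On `S`, the function `v` is the plane wave `e^{iκ e·x}` times an amplitude that is bounded by
`b` and whose rotation by the phase factor `ζ` has real part at least `a`. -/
structure IsModulatedPlaneWave {d : ℕ} (S : Set (Space d)) (e : Space d) (κ : ℝ) (ζ : ℂ) (a b : ℝ)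
    (v : Space d → ℂ) : Prop where
  norm_phase : ‖ζ‖ = 1
  le_re : ∀ x ∈ S, a ≤ (ζ * (v x * planeWave e (-κ) x)).re
  norm_le : ∀ x ∈ S, ‖v x‖ ≤ b

lemma IsModulatedPlaneWave.le_norm {d : ℕ} {S : Set (Space d)} {e : Space d} {κ a b : ℝ} {ζ : ℂ}
    {v : Space d → ℂ} (hv : IsModulatedPlaneWave S e κ ζ a b v) : ∀ x ∈ S, a ≤ ‖v x‖ :=
  fun x hx => ((hv.le_re x hx).trans (Complex.re_le_norm _)).trans_eq <| by
    rw [norm_mul, norm_mul, norm_planeWave, hv.norm_phase, one_mul, mul_one]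

namespace BoundaryStrip

variable {d : ℕ} {Ω : Set (Space d)} {e : Space d} (B : BoundaryStrip Ω e)
  {κ : ℝ} {ζ : ℂ} {a b : ℝ} {v : Space d → ℂ}

lemma integral_cutoff : ∫ p, cutoff B.α B.β p.1 ∂B.paramMeasure = B.mass * (B.β - B.α) ^ 2 / 6 := by
  rw [integral_fun_fst (μ := volume.restrict (Icc B.α B.β)) (ν := B.ν) (cutoff B.α B.β),
    setIntegral_cutoff B.lt.le, smul_eq_mul, mass]
  ring

lemma integrable_mul_planeWave_mul (hvm : AEStronglyMeasurable v (surfaceMeasure Ω))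
    {h : ℝ × ℝ → ℝ} (hh : Measurable h) {C : ℝ}
    (hC : ∀ᵐ p ∂B.paramMeasure, ‖v (B.map p) * planeWave e (-κ) (B.map p) * h p‖ ≤ C) :
    Integrable (fun p => v (B.map p) * planeWave e (-κ) (B.map p) * h p) B.paramMeasure :=
  Integrable.of_bound (((B.aestronglyMeasurable_comp hvm).mul
    (B.measurable_planeWave_map κ).aestronglyMeasurable).mul
    (Complex.measurable_ofReal.comp hh).aestronglyMeasurable) C hC

lemma ae_norm_mul_planeWave_mul_le (hvb : ∀ x ∈ B.carrier, ‖v x‖ ≤ b) {h : ℝ × ℝ → ℝ} {M : ℝ}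
    (hM : ∀ p, p.1 ∈ Icc B.α B.β → B.map p ∈ B.carrier → |h p| ≤ M) : ∀ᵐ p ∂B.paramMeasure,
      ‖v (B.map p) * planeWave e (-κ) (B.map p) * h p‖ ≤ b * M := by
  filter_upwards [B.ae_mem_param] with p hp
  rw [norm_mul, norm_mul, norm_planeWave, mul_one, Complex.norm_real, Real.norm_eq_abs]
  exact mul_le_mul (hvb _ hp.2) (hM p hp.1 hp.2) (abs_nonneg _)
    ((norm_nonneg _).trans (hvb _ hp.2))

lemma mul_mass_le_norm_integral (he : ‖e‖ = 1) (hvm : AEStronglyMeasurable v (surfaceMeasure Ω))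
    (hv : IsModulatedPlaneWave B.carrier e κ ζ a b v) (ha : 0 ≤ a) :
    a / 12 * (B.β - B.α) ^ 2 * B.mass ≤ ‖∫ p, v (B.map p) * planeWave e (-κ) (B.map p)
      * (⟪e, B.field (B.map p)⟫ * cutoff B.α B.β p.1 : ℝ) ∂B.paramMeasure‖ := by
  have hbound := B.ae_norm_mul_planeWave_mul_le (κ := κ) hv.norm_le
    (h := fun p => ⟪e, B.field (B.map p)⟫ * cutoff B.α B.β p.1) (M := 2 * (B.β - B.α) ^ 2)
    fun p hp hmem => by
      rw [abs_mul, abs_of_nonneg (cutoff_nonneg hp)]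
      exact mul_le_mul (B.abs_inner_field_le he hmem) (cutoff_le hp) (cutoff_nonneg hp) zero_le_two
  have hcut : Integrable (fun p => a / 2 * cutoff B.α B.β p.1) B.paramMeasure :=
    (((continuous_cutoff B.α B.β).integrableOn_Icc).comp_fst B.ν).const_mul _
  refine le_trans (le_of_eq ?_) (integral_le_norm_integral_of_le_re hv.norm_phase hcut
    (B.integrable_mul_planeWave_mul hvm B.measurable_inner_field_mul_cutoff hbound) ?_)
  · rw [integral_const_mul, integral_cutoff]
    ring
  · filter_upwards [B.ae_mem_param] with p hp
    rw [← mul_assoc, Complex.re_mul_ofReal, div_mul_eq_mul_div, mul_div_assoc]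
    have hre := hv.le_re _ hp.2
    have hhalf : cutoff B.α B.β p.1 / 2 ≤ ⟪e, B.field (B.map p)⟫ * cutoff B.α B.β p.1 := by
      rw [div_eq_inv_mul, ← one_div]
      exact mul_le_mul_of_nonneg_right (B.le_inner_field _ hp.2) (cutoff_nonneg hp.1)
    exact mul_le_mul hre hhalf (div_nonneg (cutoff_nonneg hp.1) zero_le_two) (ha.trans hre)

lemma mul_mass_le_norm_integral_mul_testWeight (he : ‖e‖ = 1)
    (hvm : AEStronglyMeasurable v (surfaceMeasure Ω))
    (hv : IsModulatedPlaneWave B.carrier e κ ζ a b v) (ha : 0 ≤ a) :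
    (a * |κ| / 12 * (B.β - B.α) ^ 2 - b * (B.β - B.α)) * B.mass ≤
      ‖∫ p, v (B.map p) * B.testWeight κ p ∂B.paramMeasure‖ := by
  set A : ℝ × ℝ → ℂ := fun p => v (B.map p) * planeWave e (-κ) (B.map p)
  set h : ℝ × ℝ → ℝ := fun p => ⟪e, B.field (B.map p)⟫ * cutoff B.α B.β p.1 with hh
  have hbound₁ := B.ae_norm_mul_planeWave_mul_le (κ := κ) hv.norm_le (h := h)
    (M := 2 * (B.β - B.α) ^ 2) fun p hp hmem => by
      rw [hh, abs_mul, abs_of_nonneg (cutoff_nonneg hp)]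
      exact mul_le_mul (B.abs_inner_field_le he hmem) (cutoff_le hp) (cutoff_nonneg hp) zero_le_two
  have hbound₂ := B.ae_norm_mul_planeWave_mul_le (κ := κ) hv.norm_le
    (h := fun p => B.α + B.β - 2 * p.1) fun p hp _ => abs_deriv_cutoff_le hp
  have hint₁ := B.integrable_mul_planeWave_mul hvm B.measurable_inner_field_mul_cutoff hbound₁
  have hint₂ := B.integrable_mul_planeWave_mul hvm (by fun_prop) hbound₂
  have hsplit : ∫ p, v (B.map p) * B.testWeight κ p ∂B.paramMeasure
      = κ * Complex.I * ∫ p, A p * h p ∂B.paramMeasure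
        - ∫ p, A p * (B.α + B.β - 2 * p.1 : ℝ) ∂B.paramMeasure := by
    rw [← integral_const_mul, ← integral_sub (hint₁.const_mul _) hint₂]
    refine integral_congr_ae (Eventually.of_forall fun p => ?_)
    simp only [testWeight]
    push_cast
    ring
  have hmain := mul_le_mul_of_nonneg_left (B.mul_mass_le_norm_integral he hvm hv ha) (abs_nonneg κ)
  have hrest := norm_integral_le_of_norm_le_const hbound₂
  rw [B.paramMeasure_real_univ] at hrest
  rw [hsplit]
  refine le_trans ?_ (norm_sub_norm_le _ _)
  rw [norm_mul, norm_mul, Complex.norm_I, mul_one, Complex.norm_real, Real.norm_eq_abs]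
  linarith

lemma le_normH1 (he : ‖e‖ = 1) (hmass : 0 < B.mass)
    (hv : IsModulatedPlaneWave B.carrier e κ ζ a b v) (ha : 0 ≤ a)
    (hκ : 24 * b ≤ a * |κ| * (B.β - B.α)) :
    ENNReal.ofReal (a * |κ| / 48 * √(B.mass / B.K)) ≤ normH1 Ω v := by
  refine le_iInf₂ fun g hg => ?_
  have hK : (0 : ℝ) < B.K := by exact_mod_cast B.K_pos
  have hL := B.length_pos
  have hpos : 0 < 2 * (B.β - B.α) ^ 2 * √(B.K * B.mass) := by positivity
  have hsq : √(B.mass / B.K) * √(B.K * B.mass) = B.mass := by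
    rw [← Real.sqrt_mul (by positivity), div_mul_eq_mul_div, mul_left_comm,
      mul_div_cancel_left₀ _ hK.ne', Real.sqrt_mul_self hmass.le]
  have hlow : a * |κ| / 48 * √(B.mass / B.K) * (2 * (B.β - B.α) ^ 2 * √(B.K * B.mass))
      ≤ ‖∫ p, v (B.map p) * B.testWeight κ p ∂B.paramMeasure‖ := by
    calc a * |κ| / 48 * √(B.mass / B.K) * (2 * (B.β - B.α) ^ 2 * √(B.K * B.mass))
        = a * |κ| / 24 * (B.β - B.α) ^ 2 * (√(B.mass / B.K) * √(B.K * B.mass)) := by ring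
      _ ≤ (a * |κ| / 12 * (B.β - B.α) ^ 2 - b * (B.β - B.α)) * B.mass := by
        rw [hsq]
        gcongr
        nlinarith
      _ ≤ _ := B.mul_mass_le_norm_integral_mul_testWeight he hg.1.1 hv ha
  have hgrad : ENNReal.ofReal (a * |κ| / 48 * √(B.mass / B.K))
      ≤ eLpNorm g 2 (surfaceMeasure Ω) := by
    rw [← ENNReal.mul_le_mul_iff_right (ENNReal.ofReal_pos.2 hpos).ne' ENNReal.ofReal_ne_top,
      ← ENNReal.ofReal_mul hpos.le, mul_comm (2 * _ * _)]
    refine (ENNReal.ofReal_le_ofReal hlow).trans ?_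
    rw [ofReal_norm]
    exact B.enorm_integral_mul_testWeight_le he κ hg
  calc _ ≤ eLpNorm g 2 (surfaceMeasure Ω) := hgrad
    _ = (eLpNorm g 2 (surfaceMeasure Ω) ^ 2) ^ (1 / 2 : ℝ) := by
      rw [← ENNReal.rpow_natCast, ← ENNReal.rpow_mul]
      norm_num
    _ ≤ _ := ENNReal.rpow_le_rpow le_add_self (by norm_num)

end BoundaryStrip

lemma le_opNorm {d : ℕ} {Ω : Set (Space d)} {N : (Space d → ℂ) → ℝ≥0∞}
    {T : (Space d → ℂ) → Space d → ℂ} {φ : Space d → ℂ} (hφ : MemLp φ 2 (surfaceMeasure Ω))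
    (hφ₁ : normL2 Ω φ ≤ 1) : N (T φ) ≤ opNorm Ω N T :=
  le_iSup_of_le φ (le_iSup₂_of_le hφ hφ₁ le_rfl)

section Packet

/-- The plane wave `e^{iκ e·y}` restricted to `S` and normalised in `L²(∂Ω)`. -/
def planeWavePacket {d : ℕ} (Ω : Set (Space d)) (e : Space d) (κ : ℝ) (S : Set (Space d)) :
    Space d → ℂ :=
  S.indicator fun y => ((√((surfaceMeasure Ω).real S))⁻¹ : ℝ) * planeWave e κ y

/-- The single-layer potential at `x` of the plane wave `e^{iκ e·y}` restricted to `S`, divided by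
the plane wave at `x`. -/
def potentialAmplitude {d : ℕ} (Ω : Set (Space d)) (e : Space d) (κ k : ℝ) (S : Set (Space d))
    (x : Space d) : ℂ :=
  ∫ y in S, fundamentalSolution d k x y * planeWave e (-κ) (x - y) ∂(surfaceMeasure Ω)

variable {d : ℕ} {Ω : Set (Space d)} {e : Space d} {κ : ℝ} {S : Set (Space d)}

lemma norm_planeWavePacket (x : Space d) : ‖planeWavePacket Ω e κ S x‖
    = ‖S.indicator (fun _ => (√((surfaceMeasure Ω).real S))⁻¹) x‖ := by
  simp only [planeWavePacket, norm_indicator_eq_indicator_norm, norm_mul, norm_planeWave, mul_one,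
    Complex.norm_real]

lemma memLp_planeWavePacket (hS : MeasurableSet S) (hfin : surfaceMeasure Ω S ≠ ⊤) :
    MemLp (planeWavePacket Ω e κ S) 2 (surfaceMeasure Ω) :=
  (memLp_indicator_const 2 hS _ (Or.inr hfin)).of_le
    (((continuous_planeWave e κ).const_mul _).aestronglyMeasurable.indicator hS)
    (Eventually.of_forall fun x => (norm_planeWavePacket x).le)

lemma normL2_planeWavePacket_le (hS : MeasurableSet S) (hfin : surfaceMeasure Ω S ≠ ⊤) :
    normL2 Ω (planeWavePacket Ω e κ S) ≤ 1 := by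
  rw [normL2, eLpNorm_congr_norm_ae (Eventually.of_forall norm_planeWavePacket),
    eLpNorm_indicator_const hS two_ne_zero ENNReal.ofNat_ne_top, ← ofReal_measureReal hfin,
    Real.enorm_eq_ofReal (by positivity),
    ENNReal.ofReal_rpow_of_nonneg measureReal_nonneg (by norm_num),
    ← ENNReal.ofReal_mul (by positivity), ENNReal.toReal_ofNat, ← Real.sqrt_eq_rpow]
  exact ENNReal.ofReal_le_one.2 inv_mul_le_one

lemma singleLayer_planeWavePacket_mul (hS : MeasurableSet S) (k : ℝ) (x : Space d) :
    singleLayer Ω k (planeWavePacket Ω e κ S) x * planeWave e (-κ) x =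
      ((√((surfaceMeasure Ω).real S))⁻¹ : ℝ) * potentialAmplitude Ω e κ k S x := by
  simp only [singleLayer, planeWavePacket, ← indicator_mul_right, potentialAmplitude]
  rw [integral_indicator hS, ← integral_mul_const, ← integral_const_mul]
  simp only [planeWave_neg_sub]
  congr with y
  ring

lemma isModulatedPlaneWave_singleLayer {T : Set (Space d)} {k a b : ℝ} {ζ : ℂ}
    (hS : MeasurableSet S) (hζ : ‖ζ‖ = 1)
    (ha : ∀ x ∈ T, a ≤ (ζ * potentialAmplitude Ω e κ k S x).re)
    (hb : ∀ x ∈ T, ‖potentialAmplitude Ω e κ k S x‖ ≤ b) :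
    IsModulatedPlaneWave T e κ ζ (a / √((surfaceMeasure Ω).real S))
      (b / √((surfaceMeasure Ω).real S)) (singleLayer Ω k (planeWavePacket Ω e κ S)) where
  norm_phase := hζ
  le_re x hx := by
    rw [singleLayer_planeWavePacket_mul hS, mul_left_comm, Complex.re_ofReal_mul, div_eq_inv_mul]
    gcongr
    exact ha x hx
  norm_le x hx := by
    rw [← mul_one ‖_‖, ← norm_planeWave e (-κ) x, ← norm_mul, singleLayer_planeWavePacket_mul hS,
      norm_mul, Complex.norm_real, Real.norm_of_nonneg (by positivity), div_eq_inv_mul]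
    gcongr
    exact hb x hx

end Packet

/-- The lower bounds `C k^{-1/2}` and `C k^{1/2}` for the norms of the single-layer operator from
`L²(∂Ω)` to `L²(∂Ω)` and to `H¹(∂Ω)`, at one wave number `k`. -/
def SingleLayerLowerBounds {d : ℕ} (Ω : Set (Space d)) (C k : ℝ) : Prop :=
  ENNReal.ofReal (C * k ^ (-(1 / 2) : ℝ)) ≤ opNorm Ω (normL2 Ω) (singleLayer Ω k) ∧
    ENNReal.ofReal (C * k ^ (1 / 2 : ℝ)) ≤ opNorm Ω (normH1 Ω) (singleLayer Ω k)

lemma BoundaryStrip.singleLayerLowerBounds {d : ℕ} {Ω : Set (Space d)} {e : Space d}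
    (B : BoundaryStrip Ω e) (he : ‖e‖ = 1) (hmass : 0 < B.mass) {S : Set (Space d)}
    (hS : MeasurableSet S) (hfin : surfaceMeasure Ω S ≠ ⊤) {κ k a b C : ℝ} {ζ : ℂ}
    (hκ : |κ| = k) (hk : 0 < k) (hζ : ‖ζ‖ = 1) (ha : 0 ≤ a)
    (hre : ∀ x ∈ B.carrier, a ≤ (ζ * potentialAmplitude Ω e κ k S x).re)
    (hnorm : ∀ x ∈ B.carrier, ‖potentialAmplitude Ω e κ k S x‖ ≤ b)
    (hab : 24 * b ≤ a * k * (B.β - B.α)) (hC₀ : 0 ≤ C)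
    (hC : 48 * C / √k ≤ a / √((surfaceMeasure Ω).real S) * √(B.mass / B.K)) :
    SingleLayerLowerBounds Ω C k := by
  have hwave := isModulatedPlaneWave_singleLayer hS hζ hre hnorm
  have hφ := memLp_planeWavePacket (e := e) (κ := κ) hS hfin
  have hφ₁ := normL2_planeWavePacket_le (e := e) (κ := κ) hS hfin
  set s := √((surfaceMeasure Ω).real S)
  have hs : 0 ≤ s := Real.sqrt_nonneg _
  constructor
  · refine (ENNReal.ofReal_le_ofReal ?_).trans ((B.le_normL2 (div_nonneg ha hs)
      hwave.le_norm).trans (le_opNorm hφ hφ₁))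
    rw [Real.rpow_neg hk.le, ← Real.sqrt_eq_rpow, ← div_eq_mul_inv]
    refine le_trans ?_ hC
    gcongr
    linarith
  · refine (ENNReal.ofReal_le_ofReal ?_).trans ((B.le_normH1 he hmass hwave (div_nonneg ha hs)
      ?_).trans (le_opNorm hφ hφ₁))
    · have := Real.sqrt_pos.2 hk
      calc C * k ^ (1 / 2 : ℝ) = 48 * C / √k * k / 48 := by
            rw [← Real.sqrt_eq_rpow]
            field_simp
            rw [Real.sq_sqrt hk.le]
        _ ≤ a / s * √(B.mass / B.K) * k / 48 := by gcongr
        _ = _ := by rw [hκ]; ring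
    · rw [hκ, div_mul_eq_mul_div, div_mul_eq_mul_div, mul_div_assoc']
      gcongr

/-! ### Boundaries of plane domains -/

section HausdorffFactor

/-- The constant by which the `n`-dimensional Hausdorff measure has to be multiplied in order to
agree with Lebesgue measure in dimension `n`. -/
def hausdorffFactor (n : ℕ) : ℝ≥0 :=
  Measure.addHaarScalarFactor (volume : Measure (EuclideanSpace ℝ (Fin n))) μH[n]

lemma hausdorffFactor_pos (n : ℕ) : 0 < hausdorffFactor n :=
  pos_iff_ne_zero.2 (Measure.addHaarScalarFactor_volume_hausdorffMeasure_ne_zero n)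

lemma surfaceMeasure_eq_smul {d : ℕ} (Ω : Set (Space d)) :
    surfaceMeasure Ω = hausdorffFactor (d - 1) • μH[(d - 1 : ℕ)].restrict (frontier Ω) := by
  rw [surfaceMeasure, Measure.euclideanHausdorffMeasure_def, Measure.restrict_smul,
    hausdorffFactor]

end HausdorffFactor

section Segment

variable {d : ℕ} {a e : Space d} {δ α β : ℝ}

/-- The line through `a` in the direction `e`. -/
def line (a e : Space d) (t : ℝ) : Space d := a + t • e

lemma continuous_line (a e : Space d) : Continuous (line a e) := by
  unfold line
  fun_prop

lemma hasDerivAt_line (a e : Space d) (t : ℝ) : HasDerivAt (line a e) e t := by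
  unfold line
  simpa using ((hasDerivAt_id t).smul_const e).const_add a

lemma line_sub_line (a e : Space d) (s t : ℝ) : line a e s - line a e t = (s - t) • e := by
  rw [line, line, add_sub_add_left_eq_sub, sub_smul]

lemma isometry_line (a : Space d) (he : ‖e‖ = 1) : Isometry (line a e) :=
  Isometry.of_dist_eq fun s t => by
    rw [dist_eq_norm, line_sub_line, norm_smul, he, mul_one, Real.dist_eq, Real.norm_eq_abs]

lemma isCompact_line_image_Icc (a e : Space d) (α β : ℝ) : IsCompact (line a e '' Icc α β) :=
  isCompact_Icc.image (continuous_line a e)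

lemma line_image_subset_frontier {Ω : Set (Space d)} (hseg : lineSegment a e δ ⊆ frontier Ω)
    (hα : -δ < α) (hβ : β < δ) : line a e '' Icc α β ⊆ frontier Ω := by
  rintro _ ⟨t, ht, rfl⟩
  exact hseg ⟨t, abs_lt.2 ⟨hα.trans_le ht.1, ht.2.trans_lt hβ⟩, rfl⟩

lemma mem_tangentSpan_of_mem_lineSegment {Ω : Set (Space d)}
    (hseg : lineSegment a e δ ⊆ frontier Ω) {x : Space d} (hx : x ∈ lineSegment a e δ) :
    e ∈ tangentSpan Ω x := by
  obtain ⟨t, ht, rfl⟩ := hx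
  change e ∈ tangentSpan Ω (line a e t)
  refine mem_tangentSpan_of_hasDerivAt (hasDerivAt_line a e t) ?_
  filter_upwards [continuous_abs.continuousAt.eventually_lt continuousAt_const ht] with s hs
    using hseg ⟨s, hs, rfl⟩

end Segment

section Plane

variable {Ω : Set (Space 2)} {a e : Space 2} {δ α β : ℝ}

lemma surfaceMeasure_restrict_line_image (he : ‖e‖ = 1) {J : Set ℝ} (hJ : IsCompact J)
    (hJΩ : line a e '' J ⊆ frontier Ω) :
    (surfaceMeasure Ω).restrict (line a e '' J) =
      hausdorffFactor 1 • Measure.map (line a e) (volume.restrict J) := by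
  have hiso := isometry_line a he
  have hm : MeasurableSet (line a e '' J) := (hJ.image hiso.continuous).measurableSet
  have hmap : Measure.map (line a e) volume =
      (μH[1] : Measure (Space 2)).restrict (range (line a e)) := by
    rw [← hausdorffMeasure_real]
    exact hiso.map_hausdorffMeasure (Or.inl zero_le_one)
  rw [surfaceMeasure_eq_smul, Measure.restrict_smul, Measure.restrict_restrict hm,
    inter_eq_self_of_subset_left hJΩ]
  nth_rw 2 [← preimage_image_eq J hiso.injective]
  rw [← Measure.restrict_map hiso.continuous.measurable hm, hmap, Measure.restrict_restrict hm,
    inter_eq_self_of_subset_left (image_subset_range _ _)]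
  norm_num

lemma surfaceMeasure_line_image_Icc (he : ‖e‖ = 1) (hΩ : line a e '' Icc α β ⊆ frontier Ω) :
    surfaceMeasure Ω (line a e '' Icc α β) = hausdorffFactor 1 * ENNReal.ofReal (β - α) := by
  rw [← Measure.restrict_apply_univ, surfaceMeasure_restrict_line_image he isCompact_Icc hΩ,
    Measure.smul_apply, Measure.map_apply (continuous_line a e).measurable .univ, preimage_univ,
    Measure.restrict_apply_univ, Real.volume_Icc, ENNReal.smul_def, smul_eq_mul]

/-- A compact piece of a segment contained in the boundary of a plane domain. -/
def segmentStrip (he : ‖e‖ = 1) (hseg : lineSegment a e δ ⊆ frontier Ω) (hα : -δ < α)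
    (hαβ : α < β) (hβ : β < δ) : BoundaryStrip Ω e where
  α := α
  β := β
  ν := Measure.dirac 0
  K := (hausdorffFactor 1)⁻¹
  carrier := line a e '' Icc α β
  map p := line a e p.1
  field _ := e
  lt := hαβ
  isFiniteMeasure := inferInstance
  K_pos := inv_pos.2 (hausdorffFactor_pos 1)
  measurableSet_carrier := (isCompact_line_image_Icc a e α β).measurableSet
  measurable_map := (continuous_line a e).measurable.comp measurable_fst
  measurable_field := measurable_const
  map_prod_le := by
    have hmap : Measure.map (fun p : ℝ × ℝ => line a e p.1)
        ((volume.restrict (Icc α β)).prod (Measure.dirac 0))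
          = Measure.map (line a e) (volume.restrict (Icc α β)) := by
      rw [← Function.comp_def (line a e) Prod.fst,
        ← Measure.map_map (continuous_line a e).measurable measurable_fst, Measure.map_fst_prod]
      simp
    rw [hmap, ← inv_smul_smul₀ (hausdorffFactor_pos 1).ne' (Measure.map (line a e) _),
      ← surfaceMeasure_restrict_line_image he isCompact_Icc
        (line_image_subset_frontier hseg hα hβ)]
    gcongr
    exact Measure.restrict_le_self
  ae_mem := Eventually.of_forall fun _ t ht => ⟨t, ht, rfl⟩
  ae_hasDerivAt := Eventually.of_forall fun _ t _ => hasDerivAt_line a e t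
  field_mem_tangentSpan := by
    rintro _ ⟨t, ht, rfl⟩
    exact mem_tangentSpan_of_mem_lineSegment hseg
      ⟨t, abs_lt.2 ⟨hα.trans_le ht.1, ht.2.trans_lt hβ⟩, rfl⟩
  norm_field_le _ _ := by rw [he]; norm_num
  le_inner_field _ _ := by rw [real_inner_self_eq_norm_sq, he]; norm_num

lemma segmentStrip_mass (he : ‖e‖ = 1) (hseg : lineSegment a e δ ⊆ frontier Ω) (hα : -δ < α)
    (hαβ : α < β) (hβ : β < δ) : (segmentStrip he hseg hα hαβ hβ).mass = β - α := by
  simp [BoundaryStrip.mass, segmentStrip]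

lemma fundamentalSolution_two_mul_planeWave (he : ‖e‖ = 1) (κ k : ℝ) {t t' : ℝ} (h : t' ≤ t) :
    fundamentalSolution 2 k (line a e t) (line a e t') *
        planeWave e (-κ) (line a e t - line a e t')
      = Complex.I / 4 * (hankelH0 (k * (t - t')) *
          Complex.exp ((-(κ * (t - t')) : ℝ) * Complex.I)) := by
  rw [fundamentalSolution, if_pos rfl, planeWave, line_sub_line, norm_smul, he, mul_one,
    Real.norm_of_nonneg (sub_nonneg.2 h), inner_smul_right, real_inner_self_eq_norm_sq, he,
    mul_assoc]
  norm_num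

lemma potentialAmplitude_line (he : ‖e‖ = 1) (κ k : ℝ) (hαβ : α ≤ β)
    (hΩ : line a e '' Icc α β ⊆ frontier Ω) {t : ℝ} (ht : β ≤ t) :
    potentialAmplitude Ω e κ k (line a e '' Icc α β) (line a e t) =
      (hausdorffFactor 1 / 4 : ℝ) * Complex.I * ∫ r in t - β..t - α,
        hankelH0 (k * r) * Complex.exp ((-(κ * r) : ℝ) * Complex.I) := by
  rw [potentialAmplitude, surfaceMeasure_restrict_line_image he isCompact_Icc hΩ,
    integral_smul_nnreal_measure,
    (isometry_line a he).isClosedEmbedding.measurableEmbedding.integral_map,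
    integral_Icc_eq_integral_Ioc, ← intervalIntegral.integral_of_le hαβ,
    intervalIntegral.integral_congr fun t' ht' => fundamentalSolution_two_mul_planeWave he κ k
      (((uIcc_of_le hαβ ▸ ht').2).trans ht),
    intervalIntegral.integral_const_mul, intervalIntegral.integral_comp_sub_left (fun r =>
      hankelH0 (k * r) * Complex.exp ((-(κ * r) : ℝ) * Complex.I)) t,
    NNReal.smul_def, Complex.real_smul]
  push_cast
  ring

lemma exists_potentialAmplitude_line_bounds (he : ‖e‖ = 1) {ρ : ℝ} (hρ : 0 < ρ)
    (hΩ : line a e '' Icc (-(2 * ρ)) (-ρ) ⊆ frontier Ω) :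
    ∃ (s : ℝ) (ζ : ℂ) (c C : ℝ), |s| = 1 ∧ ‖ζ‖ = 1 ∧ 0 < c ∧
      ∀ᶠ k in atTop, ∀ x ∈ line a e '' Icc ρ (2 * ρ),
        c / √k ≤ (ζ * potentialAmplitude Ω e (s * k) k (line a e '' Icc (-(2 * ρ)) (-ρ)) x).re ∧
          ‖potentialAmplitude Ω e (s * k) k (line a e '' Icc (-(2 * ρ)) (-ρ)) x‖ ≤ C / √k := by
  obtain ⟨s, ζ, c, C, hs, hζ, hc, hbounds⟩ :=
    exists_hankelH0_integral_bounds (r₀ := 2 * ρ) (r₁ := 3 * ρ) (ℓ := ρ) (by positivity)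
      (by linarith) hρ
  set n : ℝ := hausdorffFactor 1 / 4
  have hn : 0 < n := div_pos (hausdorffFactor_pos 1) four_pos
  refine ⟨s, ζ * -Complex.I, n * c, n * C, ?_, by simp [hζ], by positivity, ?_⟩
  · rwa [← sq_abs, pow_eq_one_iff_of_nonneg (abs_nonneg s) two_ne_zero] at hs
  filter_upwards [hbounds] with k hk
  rintro _ ⟨t, ht, rfl⟩
  have hint := hk (t + ρ) ⟨by linarith [ht.1], by linarith [ht.2]⟩
  rw [potentialAmplitude_line he _ _ (by linarith) hΩ (by linarith [ht.1]), sub_neg_eq_add,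
    sub_neg_eq_add, two_mul, ← add_assoc, mul_div_assoc, mul_div_assoc]
  constructor
  · rw [show ∀ J : ℂ, ζ * -Complex.I * (n * Complex.I * J) = n * (ζ * J) from fun J => by
      linear_combination (-ζ * n * J) * Complex.I_sq, Complex.re_ofReal_mul]
    gcongr
    exact hint.1
  · rw [norm_mul, norm_mul, Complex.norm_I, mul_one, Complex.norm_real,
      Real.norm_of_nonneg hn.le]
    gcongr
    exact hint.2

theorem exists_singleLayerLowerBounds_two (he : ‖e‖ = 1) (hδ : 0 < δ)
    (hseg : lineSegment a e δ ⊆ frontier Ω) :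
    ∃ C, 0 < C ∧ ∀ᶠ k in atTop, SingleLayerLowerBounds Ω C k := by
  obtain ⟨ρ, hρ, rfl⟩ : ∃ ρ, 0 < ρ ∧ δ = 3 * ρ := ⟨δ / 3, by positivity, by ring⟩
  set B := segmentStrip (α := ρ) (β := 2 * ρ) he hseg (by linarith) (by linarith) (by linarith)
  set S := line a e '' Icc (-(2 * ρ)) (-ρ)
  have hSΩ : S ⊆ frontier Ω := line_image_subset_frontier hseg (by linarith) (by linarith)
  obtain ⟨s, ζ, c, C, hs, hζ, hc, hbounds⟩ := exists_potentialAmplitude_line_bounds he hρ hSΩ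
  have hSmeas : surfaceMeasure Ω S = hausdorffFactor 1 * ENNReal.ofReal ρ := by
    rw [surfaceMeasure_line_image_Icc he hSΩ]
    ring_nf
  have hSfin : surfaceMeasure Ω S ≠ ⊤ := by
    rw [hSmeas]
    exact ENNReal.mul_ne_top ENNReal.coe_ne_top ENNReal.ofReal_ne_top
  have hSpos : 0 < (surfaceMeasure Ω).real S := by
    refine ENNReal.toReal_pos ?_ hSfin
    simpa [hSmeas, (hausdorffFactor_pos 1).ne'] using hρ
  have hB : 0 < B.mass := by
    rw [segmentStrip_mass]
    linarith
  have hA : 0 < c / √((surfaceMeasure Ω).real S) * √(B.mass / B.K) := by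
    have : (0 : ℝ) < B.K := B.K_pos
    positivity
  refine ⟨_, div_pos hA (by norm_num : (0 : ℝ) < 48), ?_⟩
  filter_upwards [hbounds, eventually_gt_atTop 0, eventually_ge_atTop (24 * C / (c * ρ))]
    with k hk hk₀ hk₁
  refine B.singleLayerLowerBounds he hB (isCompact_line_image_Icc a e _ _).measurableSet hSfin
    (κ := s * k) (by rw [abs_mul, hs, one_mul, abs_of_pos hk₀]) hk₀ hζ (by positivity)
    (fun x hx => (hk x hx).1) (fun x hx => (hk x hx).2) ?_ (by positivity) (le_of_eq (by ring))
  rw [div_le_iff₀ (by positivity)] at hk₁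
  calc 24 * (C / √k) = 24 * C / √k := by ring
    _ ≤ k * (c * ρ) / √k := by gcongr
    _ = c / √k * k * (2 * ρ - ρ) := by ring

end Plane

/-! ### Charts of `C¹` surfaces along a segment -/

section Graph

variable {d : ℕ} {ν : Space d} {γ : (ℝ ∙ ν)ᗮ → ℝ}

/-- The point of the graph of `γ` above the point `y` of the hyperplane orthogonal to `ν`. -/
def graphMap (ν : Space d) (γ : (ℝ ∙ ν)ᗮ → ℝ) (y : (ℝ ∙ ν)ᗮ) : Space d := y + γ y • ν

lemma orthogonalProjectionOnto_graphMap (y : (ℝ ∙ ν)ᗮ) :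
    (ℝ ∙ ν)ᗮ.orthogonalProjectionOnto (graphMap ν γ y) = y := by
  rw [graphMap, map_add, map_smul, Submodule.orthogonalProjectionOnto_orthogonal_apply_eq_zero
    (Submodule.mem_span_singleton_self ν), Submodule.orthogonalProjectionOnto_mem_subspace_eq_self,
    smul_zero, add_zero]

lemma inner_graphMap (hν : ‖ν‖ = 1) (y : (ℝ ∙ ν)ᗮ) : ⟪ν, graphMap ν γ y⟫ = γ y := by
  rw [graphMap, inner_add_right, Submodule.mem_orthogonal_singleton_iff_inner_right.1 y.2,
    inner_smul_right, real_inner_self_eq_norm_sq, hν]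
  ring

lemma graphMap_orthogonalProjectionOnto (hν : ‖ν‖ = 1) {x : Space d}
    (hx : ⟪ν, x⟫ = γ ((ℝ ∙ ν)ᗮ.orthogonalProjectionOnto x)) :
    graphMap ν γ ((ℝ ∙ ν)ᗮ.orthogonalProjectionOnto x) = x := by
  rw [graphMap, ← hx, Submodule.coe_orthogonalProjectionOnto_apply, add_comm,
    ← Submodule.starProjection_unit_singleton ℝ hν,
    Submodule.starProjection_add_starProjection_orthogonal]

lemma contDiff_graphMap (hγ : ContDiff ℝ 1 γ) : ContDiff ℝ 1 (graphMap ν γ) :=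
  (ℝ ∙ ν)ᗮ.subtypeL.contDiff.add (hγ.smul contDiff_const)

lemma orthogonalProjectionOnto_ne_zero_of_line_mem_graph {a e : Space d} (he : e ≠ 0)
    (hline : ∀ᶠ t in 𝓝 0,
      graphMap ν γ ((ℝ ∙ ν)ᗮ.orthogonalProjectionOnto (line a e t)) = line a e t) :
    (ℝ ∙ ν)ᗮ.orthogonalProjectionOnto e ≠ 0 := by
  intro hPe
  have hconst : ∀ᶠ t in 𝓝 0,
      line a e t = graphMap ν γ ((ℝ ∙ ν)ᗮ.orthogonalProjectionOnto a) := by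
    filter_upwards [hline] with t ht
    rw [← ht, line, map_add, map_smul, hPe, smul_zero, add_zero]
  exact he ((hasDerivAt_line a e 0).unique ((hasDerivAt_const 0 _).congr_of_eventuallyEq hconst))

lemma one_lt_finrank_orthogonal_span_singleton (hd : 2 < d) (ν : Space d) :
    1 < Module.finrank ℝ (ℝ ∙ ν)ᗮ := by
  have hsum := (ℝ ∙ ν).finrank_add_finrank_orthogonal
  have hle : Module.finrank ℝ (ℝ ∙ ν) ≤ 1 := by simpa using finrank_span_le_card {ν}
  rw [finrank_euclideanSpace_fin] at hsum
  omega

end Graph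

lemma exists_prod_embedding {E : Type*} [NormedAddCommGroup E] [NormedSpace ℝ E]
    [FiniteDimensional ℝ E] (hE : 1 < Module.finrank ℝ E) {u : E} (hu : u ≠ 0) :
    ∃ (L : ℝ × ℝ →L[ℝ] E) (R : E →L[ℝ] ℝ × ℝ), (∀ p, R (L p) = p) ∧ L (1, 0) = u := by
  obtain ⟨v, hv⟩ := exists_linearIndependent_pair_of_one_lt_finrank hE hu
  set L : ℝ × ℝ →ₗ[ℝ] E := (LinearMap.toSpanSingleton ℝ E u).coprod (.toSpanSingleton ℝ E v)
  have hL : LinearMap.ker L = ⊥ := (LinearMap.ker_eq_bot').2 fun p hp => by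
    have := LinearIndependent.pair_iff.1 hv p.1 p.2 (by simpa [L] using hp)
    exact Prod.ext this.1 this.2
  obtain ⟨R, hR⟩ := L.exists_leftInverse_of_injective hL
  exact ⟨L.toContinuousLinearMap, R.toContinuousLinearMap, LinearMap.congr_fun hR, by simp [L]⟩

/-- Near `x`, the boundary of `Ω` is the graph of a `C¹` function over a hyperplane. -/
def IsC1BoundaryAt {d : ℕ} (Ω : Set (Space d)) (x : Space d) : Prop :=
  ∃ (ν : Space d) (γ : (ℝ ∙ ν)ᗮ → ℝ), ‖ν‖ = 1 ∧ ContDiff ℝ 1 γ ∧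
    ∀ᶠ y in 𝓝 x, (y ∈ frontier Ω ↔ ⟪ν, y⟫ = γ ((ℝ ∙ ν)ᗮ.orthogonalProjectionOnto y))

lemma IsC2BoundaryAt.isC1BoundaryAt {d : ℕ} {Ω : Set (Space d)} {x : Space d}
    (h : IsC2BoundaryAt Ω x) : IsC1BoundaryAt Ω x := by
  obtain ⟨ν, γ, hν, hγ, hgraph⟩ := h
  exact ⟨ν, γ, hν, hγ.of_le one_le_two, hgraph⟩

/-- `X` is a `C¹` parametrisation of part of `∂Ω` by the square `(-ρ, ρ)²`, sending the first
coordinate axis to the line through `a` in the direction `e`, with Lipschitz left inverse `Y`. The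
square is the ball in the maximum norm of `ℝ × ℝ`. -/
structure IsSegmentChart {d : ℕ} (Ω : Set (Space d)) (a e : Space d) (ρ : ℝ) (KX KY : ℝ≥0)
    (X : ℝ × ℝ → Space d) (Y : Space d → ℝ × ℝ) : Prop where
  pos : 0 < ρ
  contDiff : ContDiff ℝ 1 X
  lipschitz_inv : LipschitzWith KY Y
  left_inv : ∀ p, Y (X p) = p
  mem : ∀ p ∈ Metric.ball (0 : ℝ × ℝ) ρ, X p ∈ frontier Ω
  axis : ∀ t, |t| < ρ → X (t, 0) = line a e t
  lipschitz : LipschitzOnWith KX X (Metric.ball 0 ρ)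
  deriv_near : ∀ p ∈ Metric.ball (0 : ℝ × ℝ) ρ, ‖fderiv ℝ X p (1, 0) - e‖ ≤ 1 / 2

section Existence

variable {d : ℕ} {Ω : Set (Space d)} {a e : Space d}

lemma hasDerivAt_comp_prodMk_left {X : ℝ × ℝ → Space d} (hX : Differentiable ℝ X) (t s : ℝ) :
    HasDerivAt (fun t => X (t, s)) (fderiv ℝ X (t, s) (1, 0)) t :=
  HasFDerivAt.comp_hasDerivAt (f := fun t : ℝ => ((t, s) : ℝ × ℝ)) t (hX (t, s)).hasFDerivAt
    ((hasDerivAt_id t).prodMk (hasDerivAt_const t s))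

lemma IsSegmentChart.of_eventually {KY : ℝ≥0} {X : ℝ × ℝ → Space d} {Y : Space d → ℝ × ℝ}
    (hX : ContDiff ℝ 1 X) (hY : LipschitzWith KY Y) (hYX : ∀ p, Y (X p) = p)
    (hmem : ∀ᶠ p in 𝓝 (0 : ℝ × ℝ), X p ∈ frontier Ω)
    (haxis : ∀ᶠ t in 𝓝 (0 : ℝ), X (t, 0) = line a e t) :
    ∃ ρ KX, IsSegmentChart Ω a e ρ KX KY X Y := by
  obtain ⟨KX, U, hU, hKX⟩ := (hX.contDiffAt (x := 0)).exists_lipschitzOnWith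
  have hderiv₀ : fderiv ℝ X 0 (1, 0) = e :=
    (hasDerivAt_comp_prodMk_left (hX.differentiable one_ne_zero) 0 0).unique
      ((hasDerivAt_line a e 0).congr_of_eventuallyEq haxis)
  have hcont : Continuous fun p => ‖fderiv ℝ X p (1, 0) - e‖ :=
    (((hX.continuous_fderiv one_ne_zero).clm_apply continuous_const).sub continuous_const).norm
  have hderiv : ∀ᶠ p in 𝓝 (0 : ℝ × ℝ), ‖fderiv ℝ X p (1, 0) - e‖ < 1 / 2 :=
    hcont.continuousAt.eventually (gt_mem_nhds (by simp only [hderiv₀]; norm_num))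
  obtain ⟨ρ₁, hρ₁, h₁⟩ := Metric.eventually_nhds_iff_ball.1 ((hmem.and hderiv).and hU)
  obtain ⟨ρ₂, hρ₂, h₂⟩ := Metric.eventually_nhds_iff_ball.1 haxis
  have hsub : Metric.ball (0 : ℝ × ℝ) (min ρ₁ ρ₂) ⊆ Metric.ball 0 ρ₁ :=
    Metric.ball_subset_ball (min_le_left _ _)
  exact ⟨min ρ₁ ρ₂, KX, lt_min hρ₁ hρ₂, hX, hY, hYX, fun p hp => (h₁ p (hsub hp)).1.1,
    fun t ht => h₂ t (by rw [mem_ball_zero_iff]; exact ht.trans_le (min_le_right _ _)),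
    hKX.mono fun p hp => (h₁ p (hsub hp)).2, fun p hp => (h₁ p (hsub hp)).1.2.le⟩

theorem exists_isSegmentChart (hd : 2 < d) (he : e ≠ 0)
    (hline : ∀ᶠ t in 𝓝 0, line a e t ∈ frontier Ω) (hC1 : IsC1BoundaryAt Ω a) :
    ∃ ρ KX KY X Y, IsSegmentChart Ω a e ρ KX KY X Y := by
  obtain ⟨ν, γ, hν, hγ, hgraph⟩ := hC1
  set P := (ℝ ∙ ν)ᗮ.orthogonalProjectionOnto
  have hline_graph : ∀ᶠ t in 𝓝 0, graphMap ν γ (P (line a e t)) = line a e t := by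
    have hcont : Tendsto (line a e) (𝓝 0) (𝓝 a) :=
      (continuous_line a e).tendsto' _ _ (by simp [line])
    filter_upwards [hline, hcont.eventually hgraph] with t hmem hiff
      using graphMap_orthogonalProjectionOnto hν (hiff.1 hmem)
  obtain ⟨L, R, hRL, hLe⟩ := exists_prod_embedding
    (one_lt_finrank_orthogonal_span_singleton hd ν)
    (orthogonalProjectionOnto_ne_zero_of_line_mem_graph he hline_graph)
  set X : ℝ × ℝ → Space d := fun p => graphMap ν γ (P a + L p)
  have hX : ContDiff ℝ 1 X :=
    (contDiff_graphMap hγ).comp (contDiff_const.add L.contDiff)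
  have hX_axis : ∀ t, X (t, 0) = graphMap ν γ (P (line a e t)) := fun t => by
    have : L (t, 0) = t • P e := by rw [← hLe, ← map_smul]; simp
    simp only [X, this, line, map_add, map_smul]
  have hX₀ : X 0 = a := by
    have := (hX_axis 0).trans hline_graph.self_of_nhds
    rwa [line, zero_smul, add_zero] at this
  have hlip : LipschitzWith (‖R.comp P‖₊ * 1) fun x => R (P (x - a)) :=
    (R.comp P).lipschitz.comp (LipschitzWith.of_dist_le_mul fun x y => by simp)
  obtain ⟨ρ, KX, hchart⟩ := IsSegmentChart.of_eventually (Ω := Ω) hX hlip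
    (fun p => by simp only [X, map_sub, P, orthogonalProjectionOnto_graphMap,
      add_sub_cancel_left, hRL])
    (by
      filter_upwards [(hX.continuous.tendsto' 0 a hX₀).eventually hgraph] with p hp
      rw [hp, inner_graphMap hν, orthogonalProjectionOnto_graphMap])
    (hline_graph.mono fun t ht => (hX_axis t).trans ht)
  exact ⟨ρ, KX, _, X, _, hchart⟩

end Existence

/-! ### Boundaries of domains in space -/

lemma surfaceMeasure_three_apply {Ω A : Set (Space 3)} (hA : MeasurableSet A) :
    surfaceMeasure Ω A = hausdorffFactor 2 * μH[2] (A ∩ frontier Ω) := by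
  rw [surfaceMeasure_eq_smul, Measure.smul_apply, Measure.restrict_apply hA, ENNReal.smul_def,
    smul_eq_mul]
  norm_num

/-- The image of the rectangle `[α, β] × [-w, w]` under the parametrisation `X`. -/
def rectImage {d : ℕ} (X : ℝ × ℝ → Space d) (α β w : ℝ) : Set (Space d) :=
  X '' (Icc α β ×ˢ Icc (-w) w)

lemma rect_subset_ball {ρ α β w : ℝ} (hα : -ρ < α) (hβ : β < ρ) (hw : w < ρ) :
    Icc α β ×ˢ Icc (-w) w ⊆ Metric.ball (0 : ℝ × ℝ) ρ := by
  rintro ⟨t, s⟩ ⟨ht, hs⟩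
  rw [mem_ball_zero_iff, Prod.norm_def]
  exact max_lt (abs_lt.2 ⟨hα.trans_le ht.1, ht.2.trans_lt hβ⟩) ((abs_le.2 hs).trans_lt hw)

namespace IsSegmentChart

section

variable {d : ℕ} {Ω : Set (Space d)} {a e : Space d} {ρ α β w : ℝ} {KX KY : ℝ≥0}
  {X : ℝ × ℝ → Space d} {Y : Space d → ℝ × ℝ}

lemma inv_lipschitzConst_pos (h : IsSegmentChart Ω a e ρ KX KY X Y) : 0 < KY := by
  refine pos_iff_ne_zero.2 fun hKY => ?_
  have hdist := h.lipschitz_inv.dist_le_mul (X (1, 0)) (X (0, 0))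
  rw [h.left_inv, h.left_inv, hKY] at hdist
  norm_num [Prod.dist_eq] at hdist

lemma isCompact_rectImage (h : IsSegmentChart Ω a e ρ KX KY X Y) (α β w : ℝ) :
    IsCompact (rectImage X α β w) :=
  (isCompact_Icc.prod isCompact_Icc).image h.contDiff.continuous

lemma hasDerivAt (h : IsSegmentChart Ω a e ρ KX KY X Y) (t s : ℝ) :
    HasDerivAt (fun t => X (t, s)) (fderiv ℝ X (t, s) (1, 0)) t :=
  hasDerivAt_comp_prodMk_left (h.contDiff.differentiable one_ne_zero) t s

lemma fderiv_mem_tangentSpan (h : IsSegmentChart Ω a e ρ KX KY X Y) {p : ℝ × ℝ}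
    (hp : p ∈ Metric.ball 0 ρ) : fderiv ℝ X p (1, 0) ∈ tangentSpan Ω (X p) := by
  refine mem_tangentSpan_of_hasDerivAt (c := fun t => X (t, p.2)) (h.hasDerivAt p.1 p.2) ?_
  have hcont : Continuous fun t : ℝ => (t, p.2) := by fun_prop
  filter_upwards [hcont.continuousAt.preimage_mem_nhds (Metric.isOpen_ball.mem_nhds hp)] with t ht
    using h.mem _ ht

lemma norm_fderiv_le (h : IsSegmentChart Ω a e ρ KX KY X Y) (he : ‖e‖ = 1) {p : ℝ × ℝ}
    (hp : p ∈ Metric.ball 0 ρ) : ‖fderiv ℝ X p (1, 0)‖ ≤ 2 := by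
  have := norm_le_norm_add_norm_sub' (fderiv ℝ X p (1, 0)) e
  linarith [h.deriv_near p hp]

lemma le_inner_fderiv (h : IsSegmentChart Ω a e ρ KX KY X Y) (he : ‖e‖ = 1) {p : ℝ × ℝ}
    (hp : p ∈ Metric.ball 0 ρ) : 1 / 2 ≤ ⟪e, fderiv ℝ X p (1, 0)⟫ := by
  have := (abs_le.1 (abs_real_inner_le_norm e (fderiv ℝ X p (1, 0) - e))).1
  rw [inner_sub_right, real_inner_self_eq_norm_sq, he] at this
  linarith [h.deriv_near p hp]

lemma norm_sub_line_le (h : IsSegmentChart Ω a e ρ KX KY X Y) {t s : ℝ}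
    (hp : (t, s) ∈ Metric.ball 0 ρ) : ‖X (t, s) - line a e t‖ ≤ KX * |s| := by
  have ht : |t| < ρ := (norm_fst_le (t, s)).trans_lt (mem_ball_zero_iff.1 hp)
  have ht₀ : (t, (0 : ℝ)) ∈ Metric.ball 0 ρ := by
    simpa [Prod.norm_def, h.pos] using ht
  rw [← h.axis t ht, ← dist_eq_norm]
  simpa [Prod.dist_eq] using h.lipschitz.dist_le_mul _ hp _ ht₀

lemma exists_sub_eq_smul_add (h : IsSegmentChart Ω a e ρ KX KY X Y) {α' β' : ℝ} (hα : -ρ < α)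
    (hβ : β < ρ) (hα' : -ρ < α') (hβ' : β' < ρ) (hw : w < ρ) {x y : Space d}
    (hx : x ∈ rectImage X α β w) (hy : y ∈ rectImage X α' β' w) :
    ∃ D ∈ Icc (α - β') (β - α'), ∃ z : Space d, ‖z‖ ≤ 2 * KX * w ∧ x - y = D • e + z := by
  obtain ⟨⟨t, s⟩, hp, rfl⟩ := hx
  obtain ⟨⟨t', s'⟩, hp', rfl⟩ := hy
  have hX := h.norm_sub_line_le (rect_subset_ball hα hβ hw hp)
  have hX' := h.norm_sub_line_le (rect_subset_ball hα' hβ' hw hp')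
  have hs : |s| ≤ w := abs_le.2 hp.2
  have hs' : |s'| ≤ w := abs_le.2 hp'.2
  refine ⟨t - t', ⟨sub_le_sub hp.1.1 hp'.1.2, sub_le_sub hp.1.2 hp'.1.1⟩,
    (X (t, s) - line a e t) - (X (t', s') - line a e t'), ?_, ?_⟩
  · calc _ ≤ KX * |s| + KX * |s'| := (norm_sub_le _ _).trans (add_le_add hX hX')
      _ ≤ KX * w + KX * w := by gcongr
      _ = 2 * KX * w := by ring
  · rw [← line_sub_line a]
    abel

end

variable {Ω : Set (Space 3)} {a e : Space 3} {ρ α β w : ℝ} {KX KY : ℝ≥0}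
  {X : ℝ × ℝ → Space 3} {Y : Space 3 → ℝ × ℝ}

lemma map_le_smul_surfaceMeasure (h : IsSegmentChart Ω a e ρ KX KY X Y) {E : Set (ℝ × ℝ)}
    (hE : E ⊆ Metric.ball 0 ρ) :
    Measure.map X (volume.restrict E) ≤ (KY ^ 2 / hausdorffFactor 2) • surfaceMeasure Ω := by
  refine Measure.le_iff.2 fun A hA => ?_
  have hX : Measurable X := h.contDiff.continuous.measurable
  rw [Measure.map_apply hX hA, Measure.restrict_apply (hX hA), Measure.smul_apply,
    surfaceMeasure_three_apply hA, ENNReal.smul_def, smul_eq_mul, ← mul_assoc, ← ENNReal.coe_mul,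
    div_mul_cancel₀ _ (hausdorffFactor_pos 2).ne', ← hausdorffMeasure_prod_real]
  calc μH[2] (X ⁻¹' A ∩ E)
      = μH[2] (Y '' (X '' (X ⁻¹' A ∩ E))) := by simp [image_image, h.left_inv]
    _ ≤ (KY : ℝ≥0∞) ^ (2 : ℝ) * μH[2] (X '' (X ⁻¹' A ∩ E)) :=
        h.lipschitz_inv.hausdorffMeasure_image_le zero_le_two _
    _ ≤ ↑(KY ^ 2) * μH[2] (A ∩ frontier Ω) := by
        rw [ENNReal.rpow_ofNat, ENNReal.coe_pow]
        gcongr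
        rintro _ ⟨p, hp, rfl⟩
        exact ⟨hp.1, h.mem p (hE hp.2)⟩

lemma surfaceMeasure_rectImage_ne_top (h : IsSegmentChart Ω a e ρ KX KY X Y) (hα : -ρ < α)
    (hβ : β < ρ) (hw : w < ρ) : surfaceMeasure Ω (rectImage X α β w) ≠ ⊤ := by
  have hle := (h.lipschitz.mono (rect_subset_ball hα hβ hw)).hausdorffMeasure_image_le zero_le_two
  rw [hausdorffMeasure_prod_real] at hle
  rw [surfaceMeasure_three_apply (h.isCompact_rectImage α β w).measurableSet]
  refine ENNReal.mul_ne_top ENNReal.coe_ne_top (ne_top_of_le_ne_top ?_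
    ((measure_mono inter_subset_left).trans hle))
  exact ENNReal.mul_ne_top (by simp) (isCompact_Icc.prod isCompact_Icc).measure_lt_top.ne

lemma area_le_surfaceMeasure_rectImage (h : IsSegmentChart Ω a e ρ KX KY X Y) (hα : -ρ < α)
    (hαβ : α ≤ β) (hβ : β < ρ) (hw₀ : 0 ≤ w) (hw : w < ρ) :
    (β - α) * (2 * w) ≤ (KY ^ 2 / hausdorffFactor 2 : ℝ≥0) *
      (surfaceMeasure Ω).real (rectImage X α β w) := by
  have hX : Measurable X := h.contDiff.continuous.measurable
  have hm := (h.isCompact_rectImage α β w).measurableSet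
  have hle := h.map_le_smul_surfaceMeasure (rect_subset_ball hα hβ hw) (rectImage X α β w)
  rw [Measure.map_apply hX hm, Measure.restrict_apply (hX hm), rectImage,
    inter_eq_self_of_subset_right (subset_preimage_image X _), ← rectImage, Measure.smul_apply,
    ENNReal.smul_def, smul_eq_mul] at hle
  have hreal := ENNReal.toReal_mono (ENNReal.mul_ne_top ENNReal.coe_ne_top
    (h.surfaceMeasure_rectImage_ne_top hα hβ hw)) hle
  rw [ENNReal.toReal_mul, ENNReal.coe_toReal] at hreal
  refine le_trans (le_of_eq ?_) hreal
  rw [← measureReal_def, Measure.volume_eq_prod, measureReal_prod_prod,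
    Real.volume_real_Icc_of_le hαβ, Real.volume_real_Icc_of_le (by linarith)]
  ring

/-- The image of a rectangle along the segment, with the lines parallel to the first axis as
curves. -/
def boundaryStrip (h : IsSegmentChart Ω a e ρ KX KY X Y) (he : ‖e‖ = 1) (hα : -ρ < α)
    (hαβ : α < β) (hβ : β < ρ) (hw : w < ρ) : BoundaryStrip Ω e where
  α := α
  β := β
  ν := volume.restrict (Icc (-w) w)
  K := KY ^ 2 / hausdorffFactor 2
  carrier := rectImage X α β w
  map := X
  field x := fderiv ℝ X (Y x) (1, 0)
  lt := hαβ
  isFiniteMeasure := inferInstance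
  K_pos := div_pos (pow_pos h.inv_lipschitzConst_pos 2) (hausdorffFactor_pos 2)
  measurableSet_carrier := (h.isCompact_rectImage α β w).measurableSet
  measurable_map := h.contDiff.continuous.measurable
  measurable_field := (((h.contDiff.continuous_fderiv one_ne_zero).clm_apply
    continuous_const).comp h.lipschitz_inv.continuous).measurable
  map_prod_le := by
    rw [Measure.prod_restrict, ← Measure.volume_eq_prod]
    exact h.map_le_smul_surfaceMeasure (rect_subset_ball hα hβ hw)
  ae_mem := (ae_restrict_mem measurableSet_Icc).mono fun s hs t ht => ⟨(t, s), ⟨ht, hs⟩, rfl⟩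
  ae_hasDerivAt := Eventually.of_forall fun s t _ => by
    rw [h.left_inv]
    exact h.hasDerivAt t s
  field_mem_tangentSpan := by
    rintro _ ⟨p, hp, rfl⟩
    rw [h.left_inv]
    exact h.fderiv_mem_tangentSpan (rect_subset_ball hα hβ hw hp)
  norm_field_le := by
    rintro _ ⟨p, hp, rfl⟩
    rw [h.left_inv]
    exact h.norm_fderiv_le he (rect_subset_ball hα hβ hw hp)
  le_inner_field := by
    rintro _ ⟨p, hp, rfl⟩
    rw [h.left_inv]
    exact h.le_inner_fderiv he (rect_subset_ball hα hβ hw hp)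

lemma boundaryStrip_mass (h : IsSegmentChart Ω a e ρ KX KY X Y) (he : ‖e‖ = 1) (hα : -ρ < α)
    (hαβ : α < β) (hβ : β < ρ) (hw₀ : 0 ≤ w) (hw : w < ρ) :
    (h.boundaryStrip he hα hαβ hβ hw).mass = (β - α) * (2 * w) := by
  rw [BoundaryStrip.mass, boundaryStrip, measureReal_restrict_apply_univ,
    Real.volume_real_Icc_of_le (by linarith)]
  ring

end IsSegmentChart

/-! ### Spherical waves in nearly parallel directions -/

section SphericalWave

variable {d : ℕ} {e z : Space d} {D r : ℝ}

lemma inner_smul_add_of_norm_eq_one (he : ‖e‖ = 1) : ⟪e, D • e + z⟫ = D + ⟪e, z⟫ := by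
  rw [inner_add_right, inner_smul_right, real_inner_self_eq_norm_sq, he, one_pow, mul_one]

lemma norm_sq_sub_inner_sq_le (he : ‖e‖ = 1) :
    ‖D • e + z‖ ^ 2 - ⟪e, D • e + z⟫ ^ 2 ≤ ‖z‖ ^ 2 := by
  rw [inner_smul_add_of_norm_eq_one he, norm_add_sq_real, norm_smul, he, mul_one,
    Real.norm_eq_abs, sq_abs, real_inner_smul_left]
  linarith [sq_nonneg ⟪e, z⟫]

lemma le_inner_smul_add (he : ‖e‖ = 1) (hD : r + ‖z‖ ≤ D) : r ≤ ⟪e, D • e + z⟫ := by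
  have hz := (abs_le.1 (abs_real_inner_le_norm e z)).1
  rw [he, one_mul] at hz
  rw [inner_smul_add_of_norm_eq_one he]
  linarith

lemma norm_sub_inner_mul_le (he : ‖e‖ = 1) (hD : r + ‖z‖ ≤ D) :
    (‖D • e + z‖ - ⟪e, D • e + z⟫) * (2 * r) ≤ ‖z‖ ^ 2 := by
  have hinner := le_inner_smul_add he hD
  have hle := real_inner_le_norm e (D • e + z)
  rw [he, one_mul] at hle
  calc (‖D • e + z‖ - ⟪e, D • e + z⟫) * (2 * r)
      ≤ (‖D • e + z‖ - ⟪e, D • e + z⟫) * (‖D • e + z‖ + ⟪e, D • e + z⟫) :=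
        mul_le_mul_of_nonneg_left (by linarith) (sub_nonneg.2 hle)
    _ = ‖D • e + z‖ ^ 2 - ⟪e, D • e + z⟫ ^ 2 := by ring
    _ ≤ ‖z‖ ^ 2 := norm_sq_sub_inner_sq_le he

end SphericalWave

lemma fundamentalSolution_three_mul_planeWave (e : Space 3) (k : ℝ) (x y : Space 3) :
    fundamentalSolution 3 k x y * planeWave e (-k) (x - y) =
      Complex.exp ((k * (‖x - y‖ - ⟪e, x - y⟫) : ℝ) * Complex.I) *
        ((4 * Real.pi * ‖x - y‖)⁻¹ : ℝ) := by
  rw [fundamentalSolution, if_neg (by norm_num), planeWave, div_mul_eq_mul_div, ← Complex.exp_add,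
    div_eq_mul_inv]
  push_cast
  ring_nf

lemma fundamentalSolution_three_mul_planeWave_bounds {e z : Space 3} {D k r : ℝ} (he : ‖e‖ = 1)
    (hr : 0 < r) (hD : D ∈ Icc (2 * r) (4 * r)) (hz : ‖z‖ ≤ r) (hk : 0 ≤ k)
    (hkz : k * ‖z‖ ^ 2 ≤ 2 * r) {x y : Space 3} (hxy : x - y = D • e + z) :
    1 / (40 * Real.pi * r) ≤ (fundamentalSolution 3 k x y * planeWave e (-k) (x - y)).re ∧
      ‖fundamentalSolution 3 k x y * planeWave e (-k) (x - y)‖ ≤ 1 / (4 * Real.pi * r) := by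
  have hDz : r + ‖z‖ ≤ D := by linarith [hD.1]
  have hinner := real_inner_le_norm e (x - y)
  rw [he, one_mul] at hinner
  have hlower : r ≤ ‖x - y‖ := (hxy ▸ le_inner_smul_add he hDz).trans hinner
  have hpos : 0 < ‖x - y‖ := hr.trans_le hlower
  have hupper : ‖x - y‖ ≤ 5 * r := by
    have := norm_add_le (D • e) z
    rw [norm_smul, he, mul_one, Real.norm_of_nonneg (by linarith [hD.1]), ← hxy] at this
    linarith [hD.2]
  have hphase₀ : 0 ≤ k * (‖x - y‖ - ⟪e, x - y⟫) := mul_nonneg hk (sub_nonneg.2 hinner)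
  have hphase : k * (‖x - y‖ - ⟪e, x - y⟫) ≤ 1 := by
    have hle := mul_le_mul_of_nonneg_left (norm_sub_inner_mul_le he hDz) hk
    rw [← hxy, ← mul_assoc] at hle
    exact (mul_le_iff_le_one_left (by positivity)).1 (hle.trans hkz)
  rw [fundamentalSolution_three_mul_planeWave]
  constructor
  · have hcos : 1 / 2 ≤ Real.cos (k * (‖x - y‖ - ⟪e, x - y⟫)) := by
      have := Real.one_sub_sq_div_two_le_cos (x := k * (‖x - y‖ - ⟪e, x - y⟫))
      nlinarith
    rw [Complex.re_mul_ofReal, Complex.exp_ofReal_mul_I_re]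
    calc 1 / (40 * Real.pi * r) = 1 / 2 * (4 * Real.pi * (5 * r))⁻¹ := by field_simp; norm_num
      _ ≤ _ := by gcongr
  · rw [norm_mul, Complex.norm_exp_ofReal_mul_I, one_mul, Complex.norm_real,
      Real.norm_of_nonneg (by positivity), one_div]
    gcongr

lemma measurable_fundamentalSolution_three (k : ℝ) (x : Space 3) :
    Measurable fun y => fundamentalSolution 3 k x y := by
  simp only [fundamentalSolution, if_neg (show ¬(3 = 2) by norm_num)]
  exact Measurable.div (Continuous.measurable (by fun_prop)) (Continuous.measurable (by fun_prop))

lemma potentialAmplitude_three_bounds {Ω S : Set (Space 3)} {e : Space 3} {κ k m M : ℝ}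
    {x : Space 3} (hS : MeasurableSet S) (hfin : surfaceMeasure Ω S ≠ ⊤)
    (hre : ∀ y ∈ S, m ≤ (fundamentalSolution 3 k x y * planeWave e (-κ) (x - y)).re)
    (hnorm : ∀ y ∈ S, ‖fundamentalSolution 3 k x y * planeWave e (-κ) (x - y)‖ ≤ M) :
    (surfaceMeasure Ω).real S * m ≤ (potentialAmplitude Ω e κ k S x).re ∧
      ‖potentialAmplitude Ω e κ k S x‖ ≤ (surfaceMeasure Ω).real S * M := by
  have : IsFiniteMeasure ((surfaceMeasure Ω).restrict S) := ⟨by simpa using hfin.lt_top⟩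
  have hint : Integrable (fun y => fundamentalSolution 3 k x y * planeWave e (-κ) (x - y))
      ((surfaceMeasure Ω).restrict S) := by
    refine Integrable.of_bound (Measurable.aestronglyMeasurable ?_) M
      ((ae_restrict_mem hS).mono hnorm)
    exact (measurable_fundamentalSolution_three k x).mul
      ((continuous_planeWave e (-κ)).comp (continuous_sub_left x)).measurable
  constructor
  · calc (surfaceMeasure Ω).real S * m = ∫ _ in S, m ∂surfaceMeasure Ω := by
          rw [setIntegral_const, smul_eq_mul]
      _ ≤ ∫ y in S, (fundamentalSolution 3 k x y * planeWave e (-κ) (x - y)).re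
            ∂surfaceMeasure Ω :=
          integral_mono_ae (integrable_const m) hint.re ((ae_restrict_mem hS).mono hre)
      _ = (potentialAmplitude Ω e κ k S x).re := integral_re hint
  · rw [mul_comm]
    exact norm_setIntegral_le_of_norm_le_const hfin.lt_top hnorm

/-! ### Lower bounds in three dimensions -/

namespace IsSegmentChart

variable {Ω : Set (Space 3)} {a e : Space 3} {ρ w k r : ℝ} {KX KY : ℝ≥0}
  {X : ℝ × ℝ → Space 3} {Y : Space 3 → ℝ × ℝ}

lemma potentialAmplitude_rectImage_bounds (h : IsSegmentChart Ω a e ρ KX KY X Y) (he : ‖e‖ = 1)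
    (hk : 0 ≤ k) (hr : 0 < r) (hrρ : 2 * r < ρ) (hw : w < ρ) (hKw : 2 * KX * w ≤ r)
    (hkw : k * (2 * KX * w) ^ 2 ≤ 2 * r) {x : Space 3} (hx : x ∈ rectImage X r (2 * r) w) :
    (surfaceMeasure Ω).real (rectImage X (-(2 * r)) (-r) w) * (1 / (40 * Real.pi * r)) ≤
        (potentialAmplitude Ω e k k (rectImage X (-(2 * r)) (-r) w) x).re ∧
      ‖potentialAmplitude Ω e k k (rectImage X (-(2 * r)) (-r) w) x‖ ≤
        (surfaceMeasure Ω).real (rectImage X (-(2 * r)) (-r) w) * (1 / (4 * Real.pi * r)) := by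
  have hbounds : ∀ y ∈ rectImage X (-(2 * r)) (-r) w,
      1 / (40 * Real.pi * r) ≤ (fundamentalSolution 3 k x y * planeWave e (-k) (x - y)).re ∧
        ‖fundamentalSolution 3 k x y * planeWave e (-k) (x - y)‖ ≤ 1 / (4 * Real.pi * r) := by
    intro y hy
    obtain ⟨D, hD, z, hz, hxy⟩ := h.exists_sub_eq_smul_add (by linarith) hrρ (by linarith)
      (by linarith) hw hx hy
    exact fundamentalSolution_three_mul_planeWave_bounds he hr
      ⟨by linarith [hD.1], by linarith [hD.2]⟩ (hz.trans hKw) hk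
      (hkw.trans' (by gcongr)) hxy
  exact potentialAmplitude_three_bounds (h.isCompact_rectImage _ _ w).measurableSet
    (h.surfaceMeasure_rectImage_ne_top (by linarith) (by linarith) hw)
    (fun y hy => (hbounds y hy).1) fun y hy => (hbounds y hy).2

lemma singleLayerLowerBounds (h : IsSegmentChart Ω a e ρ KX KY X Y) (he : ‖e‖ = 1)
    (hr : 0 < r) (hrρ : 2 * r < ρ) (hk : 0 < k) (hkr : 240 ≤ k * r) (hw₀ : 0 < w) (hw : w < ρ)
    (hKw : 2 * KX * w ≤ r) (hkw : k * (2 * KX * w) ^ 2 ≤ 2 * r) :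
    SingleLayerLowerBounds Ω (√k * w / (960 * Real.pi * (KY ^ 2 / hausdorffFactor 2))) k := by
  have hα : -ρ < -(2 * r) := by linarith
  have hβ : -r < ρ := by linarith
  set S := rectImage X (-(2 * r)) (-r) w
  set σ := (surfaceMeasure Ω).real S
  set B := h.boundaryStrip he (α := r) (by linarith) (by linarith) hrρ hw
  have hBmass : B.mass = r * (2 * w) := by
    rw [h.boundaryStrip_mass he _ _ _ hw₀.le]
    ring
  have hK : (0 : ℝ) < B.K := B.K_pos
  have hσ : B.mass / B.K ≤ σ := by
    rw [div_le_iff₀' hK, hBmass]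
    refine le_trans (le_of_eq ?_)
      (h.area_le_surfaceMeasure_rectImage hα (by linarith) hβ hw₀.le hw)
    ring
  have hbounds := fun x (hx : x ∈ B.carrier) =>
    h.potentialAmplitude_rectImage_bounds he hk.le hr hrρ hw hKw hkw hx
  refine B.singleLayerLowerBounds he (hBmass ▸ by positivity)
    (h.isCompact_rectImage _ _ w).measurableSet (h.surfaceMeasure_rectImage_ne_top hα hβ hw)
    (abs_of_pos hk) hk norm_one (a := σ * (1 / (40 * Real.pi * r))) (by positivity)
    (fun x hx => (one_mul (potentialAmplitude _ _ _ _ _ x)).symm ▸ (hbounds x hx).1)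
    (fun x hx => (hbounds x hx).2) ?_ (by positivity) ?_
  · calc 24 * (σ * (1 / (4 * Real.pi * r))) = σ * (1 / (40 * Real.pi * r)) * 240 := by
          field_simp; ring
      _ ≤ σ * (1 / (40 * Real.pi * r)) * (k * r) := by gcongr
      _ = σ * (1 / (40 * Real.pi * r)) * k * (2 * r - r) := by ring
  · calc 48 * (√k * w / (960 * Real.pi * B.K)) / √k
        = B.mass / B.K * (1 / (40 * Real.pi * r)) := by
          rw [hBmass]
          field_simp
          norm_num
      _ = √(B.mass / B.K) * (1 / (40 * Real.pi * r)) * √(B.mass / B.K) := by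
          rw [mul_right_comm √(B.mass / B.K), Real.mul_self_sqrt (div_nonneg B.mass_nonneg hK.le)]
      _ ≤ √σ * (1 / (40 * Real.pi * r)) * √(B.mass / B.K) := by gcongr
      _ = σ * (1 / (40 * Real.pi * r)) / √σ * √(B.mass / B.K) := by
          rw [mul_div_right_comm, Real.div_sqrt]

end IsSegmentChart

lemma exists_forall_mul_sq_div_sqrt_le (K : ℝ) {r : ℝ} (hr : 0 < r) :
    ∃ ε > 0, ∀ k > 0, k * (K * (ε / √k)) ^ 2 ≤ r := by
  have hlim : Tendsto (fun ε : ℝ => (K * ε) ^ 2) (𝓝 0) (𝓝 0) :=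
    Continuous.tendsto' (by fun_prop) _ _ (by simp)
  obtain ⟨ε, hε, hε₀⟩ := (((hlim.eventually (ge_mem_nhds hr)).filter_mono nhdsWithin_le_nhds).and
    (self_mem_nhdsWithin : Ioi (0 : ℝ) ∈ 𝓝[>] 0)).exists
  refine ⟨ε, hε₀, fun k hk => ?_⟩
  rwa [mul_div_assoc', div_pow, Real.sq_sqrt hk.le, mul_div_cancel₀ _ hk.ne']

theorem exists_singleLayerLowerBounds_three {Ω : Set (Space 3)} {a e : Space 3} {δ : ℝ}
    (he : ‖e‖ = 1) (hδ : 0 < δ) (hseg : lineSegment a e δ ⊆ frontier Ω)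
    (hC1 : IsC1BoundaryAt Ω a) : ∃ C, 0 < C ∧ ∀ᶠ k in atTop, SingleLayerLowerBounds Ω C k := by
  have hline : ∀ᶠ t in 𝓝 0, line a e t ∈ frontier Ω := by
    filter_upwards [Metric.ball_mem_nhds (0 : ℝ) hδ] with t ht
    exact hseg ⟨t, by simpa using ht, rfl⟩
  obtain ⟨ρ, KX, KY, X, Y, h⟩ :=
    exists_isSegmentChart (by norm_num) (norm_ne_zero_iff.1 (he ▸ one_ne_zero)) hline hC1
  obtain ⟨r, hr, hrρ⟩ : ∃ r, 0 < r ∧ 2 * r < ρ := ⟨ρ / 3, by linarith [h.pos], by linarith [h.pos]⟩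
  obtain ⟨ε, hε, hphase⟩ := exists_forall_mul_sq_div_sqrt_le (2 * KX) (mul_pos two_pos hr)
  have hwidth : Tendsto (fun k => ε / √k) atTop (𝓝 0) :=
    tendsto_const_nhds.div_atTop Real.tendsto_sqrt_atTop
  have hKwidth : Tendsto (fun k => 2 * KX * (ε / √k)) atTop (𝓝 0) := by
    simpa using hwidth.const_mul (2 * KX : ℝ)
  have hKY : (0 : ℝ) < KY := h.inv_lipschitzConst_pos
  have hfactor : (0 : ℝ) < hausdorffFactor 2 := hausdorffFactor_pos 2
  refine ⟨ε / (960 * Real.pi * (KY ^ 2 / hausdorffFactor 2)), by positivity, ?_⟩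
  filter_upwards [eventually_gt_atTop 0, eventually_ge_atTop (240 / r),
    hwidth.eventually (gt_mem_nhds h.pos), hKwidth.eventually (ge_mem_nhds hr)]
    with k hk hkr hw hKw
  have hbounds := h.singleLayerLowerBounds he hr hrρ hk ((div_le_iff₀ hr).1 hkr)
    (div_pos hε (Real.sqrt_pos.2 hk)) hw hKw (hphase k hk)
  rwa [mul_div_cancel₀ _ (Real.sqrt_pos.2 hk).ne'] at hbounds

end Helmholtz

end

theorem lemma3p1_general {d : ℕ} {Ω : Set (Helmholtz.Space d)} {a e : Helmholtz.Space d} {δ : ℝ}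
    (hd : d = 2 ∨ d = 3 ∧ Helmholtz.IsC1BoundaryAt Ω a) (he : ‖e‖ = 1) (hδ : 0 < δ)
    (hseg : Helmholtz.lineSegment a e δ ⊆ frontier Ω) :
    ∃ k₀ C : ℝ, 0 < k₀ ∧ 0 < C ∧ ∀ k : ℝ, k₀ ≤ k → Helmholtz.SingleLayerLowerBounds Ω C k := by
  obtain ⟨C, hC, hbounds⟩ :
      ∃ C, 0 < C ∧ ∀ᶠ k in atTop, Helmholtz.SingleLayerLowerBounds Ω C k := by
    rcases hd with rfl | ⟨rfl, hC1⟩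
    · exact Helmholtz.exists_singleLayerLowerBounds_two he hδ hseg
    · exact Helmholtz.exists_singleLayerLowerBounds_three he hδ hseg hC1
  obtain ⟨k₁, hk₁⟩ := eventually_atTop.1 hbounds
  exact ⟨max k₁ 1, C, by positivity, hC, fun k hk => hk₁ k ((le_max_left k₁ 1).trans hk)⟩

theorem lemma3p1 (d : ℕ) (hd : d = 2 ∨ d = 3) (Ω : Set (Helmholtz.Space d))
    (hΩ : Helmholtz.IsLipschitzObstacle Ω)
    (a e : Helmholtz.Space d) (δ : ℝ) (he : ‖e‖ = 1) (hδ : 0 < δ)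
    (hseg : Helmholtz.lineSegment a e δ ⊆ frontier Ω)
    (hC2 : Helmholtz.IsC2BoundaryNear Ω (Helmholtz.lineSegment a e δ)) :
    ∃ k₀ C : ℝ, 0 < k₀ ∧ 0 < C ∧ ∀ k : ℝ, k₀ ≤ k →
      ENNReal.ofReal (C * k ^ (-(1 / 2) : ℝ))
          ≤ Helmholtz.opNorm Ω (Helmholtz.normL2 Ω) (Helmholtz.singleLayer Ω k) ∧
      ENNReal.ofReal (C * k ^ (1 / 2 : ℝ))
          ≤ Helmholtz.opNorm Ω (Helmholtz.normH1 Ω) (Helmholtz.singleLayer Ω k) := by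
  have ha : Helmholtz.IsC2BoundaryAt Ω a := by
    obtain ⟨V, -, hV, hsmooth⟩ := hC2
    have ha : a ∈ Helmholtz.lineSegment a e δ := ⟨0, by simpa using hδ, by simp⟩
    exact hsmooth a ⟨hV ha, hseg ha⟩
  exact lemma3p1_general (hd.imp_right fun h => ⟨h, ha.isC1BoundaryAt⟩) he hδ hseg
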